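/- **Setting.** A *local language* $L$ is a many-sorted first-order language whose only function symbols are constants, together with, for every single sort $s$, a partially ordered monoid $\mathtt{D}^s$ of binary relation symbols on $s$ (the *locality relation symbols*), whose identity is the equality symbol and is the least element, and a function assigning to any two constants $c_1,c_2$ of the same sort a symbol $B_{c_1,c_2}\in\mathtt{D}^s$. A *local structure* is an $L$-structure $M$ (with non-empty sorts) in which: every locality relation is symmetric; $d_1\preceq d_2$ implies $d_1^M\subseteq d_2^M$; $d_1^M\circ d_2^M\subseteq(d_1* d_2)^M$; $B_{c_1,c_2}(c_1,c_2)$ holds for all constants $c_1,c_2$ of the same sort; and any two elements of the same sort satisfy some locality relation. *Positive* formulas are built from atomic formulas by $\wedge,\vee,\exists$; *local positive* formulas are built from atomic formulas by $\wedge,\vee$ and local quantifiers $\exists x\,(d(x,t)\wedge\cdot)$, with $d$ a locality relation symbol and $t$ a term not containing $x$. Negative formulas are negations of positive ones. A *negative local theory* $T$ is a set of negative sentences containing every negative sentence that holds in all local models of $T$. A *retractor* of $T$ is a local model $R$ of $T$ such that for every homomorphism $f\colon R\to N$ to a local model $N$ of $T$ there is a homomorphism $g\colon N\to R$ with $g\circ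 f=\mathrm{id}$. For a variable $x$ (a set of single variables, each with a sort), the *local positive logic topology* on $R^x$ has as closed sets the empty set and the sets defined by (possibly infinite) sets of local positive formulas $\varphi(x)$ with parameters in $R$. A locality relation $d$ on the sort of $x$ is a choice of a locality relation symbol $d_i$ for each single variable $x_i$ in $x$; $d(a,b)$ means $d_i(a_i,b_i)$ for all $i$, and the *ball* of $d$ at $b\in R^x$ is $d(b)=\{a\in R^x : d(b,a)\}$. The *pointwise topology* on the set of all (sort-preserving) functions $R\to R$, and on the automorphism group $\mathrm{Aut}(R)$, is the initial topology given by the evaluation maps $\mathrm{ev}_a\colon f\mapsto f(a)\in R^x$ for $x$ a finite variable and $a\in R^x$. For a choice $d=(d_s)_s$ of a locality relation and $a=(a_s)_s$ of a point in each single sort $s$, the *$d$-ball at $a$* in $\mathrm{Aut}(R)$ is $\{\sigma : \sigma(a_s)\in d_s(a_s)\text{ for each single sort }s\}$. A *denial* (in $T$) of $\varphi$ is a positive formula $\theta$ in the same variables such that $\varphi\wedge\theta$ is realised in no local model of $T$. An *entourage* in $d$ is a pair of local positive formulas $\psi(x,y),\varphi(x,y)$ (with $y$ a disjoint copy of $x$)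 such that every denial of $d(x,y)$ is a denial of $\psi$; $\varphi(x,y)\wedge x=y$ is realised in no local model of $T$; and, for every denial $\theta$ of $\psi$, every denial of $\varphi$ is a denial of $\theta$. **Theorem.** Let $T$ be a negative local theory in a local language and $R$ a retractor of $T$. Then: 1. $\mathrm{Aut}(R)$ is a closed subspace of the space of all functions from $R$ to itself with the pointwise topology. 2. If $B$ is a ball in $R^x$, $F\subseteq B$ is closed and $U\subseteq R^x$ is open, then $\{\sigma\in\mathrm{Aut}(R) : \sigma(F)\subseteq U\}$ is open. In particular, if there is an entourage on $R^x$ (that is, in some locality relation on the sort of $x$), then $\{\sigma\in\mathrm{Aut}(R) : \sigma(F)\subseteq U\}$ is open for every closed compact $F\subseteq R^x$ and every open $U\subseteq R^x$. 3. $\mathrm{Aut}(R)$ is $\mathrm{T}_1$. 4. Every ball of $\mathrm{Aut}(R)$ is compact. 5. The inversion map $\sigma\mapsto\sigma^{-1}$ and all left and right translations of $\mathrm{Aut}(R)$ are continuous, i.e. $\mathrm{Aut}(R)$ is a semitopological group. -/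

import Mathlib

universe u

namespace LocalPositiveLogic

/-- A (many-sorted) local first-order language: a relational language with constants, in which
every single sort carries a partially ordered monoid of locality relation symbols, together with a
bound function on pairs of constant symbols of the same sort.

The relation symbols of the language are the symbols in `Rel l` (with `l` the list of the sorts of
the arguments) together with the binary symbols in `Loc s` on each sort `s`.
The identity `1 : Loc s` is the equality symbol of sort `s`. -/
structure LocalLanguage where
  /-- The single sorts. -/
  Srt : Type u
  /-- Relation symbols, by the list of sorts of their arguments. -/
  Rel : List Srt → Type u
  /-- Constant symbols of each sort. -/
  Const : Srt → Type u
  /-- Locality relation symbols of each sort. -/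
  Loc : Srt → Type u
  [locMonoid : ∀ s, Monoid (Loc s)]
  [locOrder : ∀ s, PartialOrder (Loc s)]
  /-- The product is monotone, so that `Loc s` is a partially ordered monoid. -/
  loc_mul_le_mul : ∀ {s : Srt} {d₁ d₁' d₂ d₂' : Loc s},
    d₁ ≤ d₁' → d₂ ≤ d₂' → d₁ * d₂ ≤ d₁' * d₂'
  /-- The equality symbol is the least locality relation symbol. -/
  one_le_loc : ∀ {s : Srt} (d : Loc s), 1 ≤ d
  /-- The bound function. -/
  bound : ∀ {s : Srt}, Const s → Const s → Loc s

attribute [instance] LocalLanguage.locMonoid LocalLanguage.locOrder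

/-! ### Formulas -/

/-- Bound variables of sort `s` in a list `Γ` of sorts (well-sorted de Bruijn indices). -/
inductive BVar {S : Type u} : List S → S → Type u
  | zero {s : S} {Γ : List S} : BVar (s :: Γ) s
  | succ {s t : S} {Γ : List S} (v : BVar Γ s) : BVar (t :: Γ) s

/-- Terms of sort `s`: free variables from the set of variables `V` (where `V s` is the set of
single variables of sort `s`), bound variables, and constant symbols. -/
inductive Term (L : LocalLanguage.{u}) (V : L.Srt → Type u) (Γ : List L.Srt) (s : L.Srt) : Type u
  | free (v : V s) : Term L V Γ s
  | bvar (v : BVar Γ s) : Term L V Γ s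
  | const (c : L.Const s) : Term L V Γ s

/-- A term seen as a term in a context with one more bound variable, which does not appear in
it. -/
def Term.weaken {L : LocalLanguage.{u}} {V : L.Srt → Type u} {Γ : List L.Srt} {s : L.Srt}
    (t : L.Srt) : Term L V Γ s → Term L V (t :: Γ) s
  | .free v => .free v
  | .bvar v => .bvar v.succ
  | .const c => .const c

/-- First-order formulas with free variables in `V` and bound variables in `Γ`.
Atomic equalities are the formulas `loc 1 t t'`. -/
inductive BFormula (L : LocalLanguage.{u}) (V : L.Srt → Type u) : List L.Srt → Type u
  | loc {Γ : List L.Srt} {s : L.Srt} (d : L.Loc s) (t t' : Term L V Γ s) : BFormula L V Γ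
  | rel {Γ : List L.Srt} {l : List L.Srt} (R : L.Rel l)
      (ts : ∀ i : Fin l.length, Term L V Γ (l.get i)) : BFormula L V Γ
  | not {Γ : List L.Srt} (φ : BFormula L V Γ) : BFormula L V Γ
  | and {Γ : List L.Srt} (φ ψ : BFormula L V Γ) : BFormula L V Γ
  | or {Γ : List L.Srt} (φ ψ : BFormula L V Γ) : BFormula L V Γ
  | ex {Γ : List L.Srt} (s : L.Srt) (φ : BFormula L V (s :: Γ)) : BFormula L V Γ

/-- Formulas `φ(x)` on the variable `x`, given by the sets `V s` of single variables of sort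
`s` in `x`. -/
abbrev Formula (L : LocalLanguage.{u}) (V : L.Srt → Type u) : Type u := BFormula L V []

/-- Sentences: formulas without free variables. -/
abbrev Sentence (L : LocalLanguage.{u}) : Type u := Formula L (fun _ => PEmpty.{u + 1})

section Formulas

variable {L : LocalLanguage.{u}} {V : L.Srt → Type u}

/-- The local existential quantification `∃ x ∈ d(t), φ`, that is, `∃ x, d(x, t) ∧ φ`. -/
def BFormula.exLoc {Γ : List L.Srt} {s : L.Srt} (d : L.Loc s) (t : Term L V Γ s)
    (φ : BFormula L V (s :: Γ)) : BFormula L V Γ :=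
  .ex s (.and (.loc d (.bvar .zero) (t.weaken s)) φ)

/-- Positive formulas: built from atomic formulas by conjunctions, disjunctions and existential
quantifiers. -/
inductive IsPositive : ∀ {Γ : List L.Srt}, BFormula L V Γ → Prop
  | loc {Γ : List L.Srt} {s : L.Srt} (d : L.Loc s) (t t' : Term L V Γ s) :
      IsPositive (.loc d t t')
  | rel {Γ : List L.Srt} {l : List L.Srt} (R : L.Rel l)
      (ts : ∀ i : Fin l.length, Term L V Γ (l.get i)) : IsPositive (.rel R ts)
  | and {Γ : List L.Srt} {φ ψ : BFormula L V Γ} :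
      IsPositive φ → IsPositive ψ → IsPositive (.and φ ψ)
  | or {Γ : List L.Srt} {φ ψ : BFormula L V Γ} :
      IsPositive φ → IsPositive ψ → IsPositive (.or φ ψ)
  | ex {Γ : List L.Srt} {s : L.Srt} {φ : BFormula L V (s :: Γ)} :
      IsPositive φ → IsPositive (.ex s φ)

/-- Local positive formulas: built from atomic formulas by conjunctions, disjunctions and local
existential quantifiers. -/
inductive IsLocalPositive : ∀ {Γ : List L.Srt}, BFormula L V Γ → Prop
  | loc {Γ : List L.Srt} {s : L.Srt} (d : L.Loc s) (t t' : Term L V Γ s) :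
      IsLocalPositive (.loc d t t')
  | rel {Γ : List L.Srt} {l : List L.Srt} (R : L.Rel l)
      (ts : ∀ i : Fin l.length, Term L V Γ (l.get i)) : IsLocalPositive (.rel R ts)
  | and {Γ : List L.Srt} {φ ψ : BFormula L V Γ} :
      IsLocalPositive φ → IsLocalPositive ψ → IsLocalPositive (.and φ ψ)
  | or {Γ : List L.Srt} {φ ψ : BFormula L V Γ} :
      IsLocalPositive φ → IsLocalPositive ψ → IsLocalPositive (.or φ ψ)
  | exLoc {Γ : List L.Srt} {s : L.Srt} (d : L.Loc s) (t : Term L V Γ s)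
      {φ : BFormula L V (s :: Γ)} : IsLocalPositive φ → IsLocalPositive (.exLoc d t φ)

/-- Negative formulas: negations of positive formulas. -/
def IsNegative {Γ : List L.Srt} (φ : BFormula L V Γ) : Prop :=
  ∃ ψ : BFormula L V Γ, IsPositive ψ ∧ φ = .not ψ

end Formulas

/-! ### Structures and satisfaction -/

/-- Structures for the underlying first-order language (not necessarily local). -/
structure LStructure (L : LocalLanguage.{u}) where
  carrier : L.Srt → Type u
  nonempty : ∀ s, Nonempty (carrier s)
  relMap : ∀ {l : List L.Srt}, L.Rel l → (∀ i : Fin l.length, carrier (l.get i)) → Prop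
  constMap : ∀ {s : L.Srt}, L.Const s → carrier s
  locMap : ∀ {s : L.Srt}, L.Loc s → carrier s → carrier s → Prop
  /-- The symbol `1` is the equality symbol. -/
  locMap_one : ∀ {s : L.Srt} (a b : carrier s), locMap 1 a b ↔ a = b

/-- The locality axioms. -/
structure LStructure.IsLocal {L : LocalLanguage.{u}} (M : LStructure L) : Prop where
  symm : ∀ {s : L.Srt} (d : L.Loc s) (a b : M.carrier s), M.locMap d a b → M.locMap d b a
  mono : ∀ {s : L.Srt} (d₁ d₂ : L.Loc s), d₁ ≤ d₂ →
    ∀ a b : M.carrier s, M.locMap d₁ a b → M.locMap d₂ a b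
  comp : ∀ {s : L.Srt} (d₁ d₂ : L.Loc s) (a b c : M.carrier s),
    M.locMap d₁ a b → M.locMap d₂ b c → M.locMap (d₁ * d₂) a c
  bound : ∀ {s : L.Srt} (c₁ c₂ : L.Const s),
    M.locMap (L.bound c₁ c₂) (M.constMap c₁) (M.constMap c₂)
  exists_loc : ∀ {s : L.Srt} (a b : M.carrier s), ∃ d : L.Loc s, M.locMap d a b

section Semantics

variable {L : LocalLanguage.{u}}

/-- The set `M^x` of tuples of elements of `M`, for the variable `x` given by the sets `X s` of
single variables of sort `s`. -/
def Tuple (M : LStructure L) (X : L.Srt → Type u) : Type u := ∀ s, X s → M.carrier s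

/-- Extending an assignment of the bound variables. -/
def consVal {C : L.Srt → Type u} {Γ : List L.Srt} {s : L.Srt} (a : C s)
    (b : ∀ t, BVar Γ t → C t) : ∀ t, BVar (s :: Γ) t → C t
  | _, .zero => a
  | _, .succ v => b _ v

/-- Interpretation of terms. -/
def Term.eval {V : L.Srt → Type u} {Γ : List L.Srt} {s : L.Srt} (M : LStructure L)
    (v : Tuple M V) (b : ∀ t, BVar Γ t → M.carrier t) : Term L V Γ s → M.carrier s
  | .free x => v s x
  | .bvar x => b s x
  | .const c => M.constMap c

/-- Satisfaction of formulas under an assignment of the free and the bound variables. -/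
def BFormula.RealizeB {V : L.Srt → Type u} (M : LStructure L) (v : Tuple M V) :
    ∀ {Γ : List L.Srt}, BFormula L V Γ → (∀ t, BVar Γ t → M.carrier t) → Prop
  | _, .loc d t t', b => M.locMap d (t.eval M v b) (t'.eval M v b)
  | _, .rel R ts, b => M.relMap R (fun i => (ts i).eval M v b)
  | _, .not φ, b => ¬ φ.RealizeB M v b
  | _, .and φ ψ, b => φ.RealizeB M v b ∧ ψ.RealizeB M v b
  | _, .or φ ψ, b => φ.RealizeB M v b ∨ ψ.RealizeB M v b
  | _, .ex s φ, b => ∃ a : M.carrier s, φ.RealizeB M v (consVal a b)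

/-- `M ⊨ φ(v)`. -/
def Formula.Realize {V : L.Srt → Type u} (φ : Formula L V) (M : LStructure L) (v : Tuple M V) :
    Prop :=
  BFormula.RealizeB M v φ (fun _ x => nomatch x)

/-- `M ⊨ φ` for a sentence `φ`. -/
def Sentence.Holds (φ : Sentence L) (M : LStructure L) : Prop :=
  Formula.Realize φ M (fun _ x => nomatch x)

/-- `M` is a local model of the set of sentences `T`. -/
def IsLocalModel (T : Set (Sentence L)) (M : LStructure L) : Prop :=
  M.IsLocal ∧ ∀ φ ∈ T, Sentence.Holds φ M

/-- A negative local theory: a set of negative sentences closed under local implication. -/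
structure IsNegativeLocalTheory (T : Set (Sentence L)) : Prop where
  isNegative : ∀ φ ∈ T, IsNegative φ
  closed : ∀ φ : Sentence L, IsNegative φ →
    (∀ M : LStructure L, IsLocalModel T M → Sentence.Holds φ M) → φ ∈ T

/-- Homomorphisms of structures. (Equality, the symbol `1`, is preserved by every map.) -/
structure IsHom {M N : LStructure L} (f : ∀ s, M.carrier s → N.carrier s) : Prop where
  map_rel : ∀ {l : List L.Srt} (R : L.Rel l) (a : ∀ i : Fin l.length, M.carrier (l.get i)),
    M.relMap R a → N.relMap R (fun i => f _ (a i))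
  map_const : ∀ {s : L.Srt} (c : L.Const s), f s (M.constMap c) = N.constMap c
  map_loc : ∀ {s : L.Srt} (d : L.Loc s) (a b : M.carrier s),
    M.locMap d a b → N.locMap d (f s a) (f s b)

/-- A retractor of `T`: a local model `R` of `T` such that every homomorphism from `R` to a local
model of `T` has a retraction. -/
def IsRetractor (T : Set (Sentence L)) (R : LStructure L) : Prop :=
  IsLocalModel T R ∧
    ∀ N : LStructure L, IsLocalModel T N →
      ∀ f : ∀ s, R.carrier s → N.carrier s, IsHom f →
        ∃ g : ∀ s, N.carrier s → R.carrier s, IsHom g ∧ ∀ s (a : R.carrier s), g s (f s a) = a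

/-! ### The local positive logic topology -/

/-- Formulas `φ(x)` with parameters from `M`, on the variable `x` given by `X`. -/
abbrev PFormula (M : LStructure L) (X : L.Srt → Type u) : Type u :=
  Formula L (fun s => X s ⊕ M.carrier s)

/-- `M ⊨ φ(a)` for a formula `φ(x)` with parameters from `M`. -/
def PFormula.Realize {M : LStructure L} {X : L.Srt → Type u} (φ : PFormula M X) (a : Tuple M X) :
    Prop :=
  Formula.Realize φ M (fun s => Sum.elim (a s) id)

/-- Subsets of `M^x` defined by a set of local positive formulas with parameters from `M`. -/
def IsLocalPositiveTypeDefinable {M : LStructure L} {X : L.Srt → Type u} (D : Set (Tuple M X)) :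
    Prop :=
  ∃ Δ : Set (PFormula M X), (∀ φ ∈ Δ, IsLocalPositive φ) ∧
    D = {a | ∀ φ ∈ Δ, PFormula.Realize φ a}

/-- The local positive logic topology of `M^x`: the closed sets are the empty set and the sets
defined by a set of local positive formulas with parameters from `M`. -/
instance localPositiveLogicTopology (M : LStructure L) (X : L.Srt → Type u) :
    TopologicalSpace (Tuple M X) :=
  TopologicalSpace.ofClosed {D | D = ∅ ∨ IsLocalPositiveTypeDefinable D}
    (Or.inl rfl)
    (by
      intro A hA
      by_cases h : ∅ ∈ A
      · exact Or.inl (Set.subset_empty_iff.mp (Set.sInter_subset_of_mem h))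
      · refine Or.inr ⟨{φ | IsLocalPositive φ ∧ ∃ D ∈ A, ∀ a ∈ D, PFormula.Realize φ a},
          fun φ hφ => hφ.1, ?_⟩
        ext a
        constructor
        · rintro ha φ ⟨-, D, hD, h'⟩
          exact h' a (ha D hD)
        · intro ha D hD
          rcases hA hD with rfl | ⟨Δ, hΔ, rfl⟩
          · exact absurd hD h
          · exact fun φ hφ => ha φ ⟨hΔ φ hφ, _, hD, fun b hb => hb φ hφ⟩)
    (by
      rintro A (rfl | ⟨Δ, hΔ, rfl⟩) B (rfl | ⟨Δ', hΔ', rfl⟩)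
      · exact Or.inl (Set.union_empty _)
      · exact Or.inr ⟨Δ', hΔ', Set.empty_union _⟩
      · exact Or.inr ⟨Δ, hΔ, Set.union_empty _⟩
      · refine Or.inr ⟨{θ | ∃ φ ∈ Δ, ∃ ψ ∈ Δ', θ = .or φ ψ}, ?_, ?_⟩
        · rintro θ ⟨φ, hφ, ψ, hψ, rfl⟩
          exact .or (hΔ φ hφ) (hΔ' ψ hψ)
        · ext a
          constructor
          · rintro (ha | ha) θ ⟨φ, hφ, ψ, hψ, rfl⟩
            · exact Or.inl (ha φ hφ)
            · exact Or.inr (ha ψ hψ)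
          · intro ha
            by_contra hcon
            simp only [Set.mem_union, Set.mem_ofPred_eq, not_or, not_forall] at hcon
            obtain ⟨⟨φ, hφ, h1⟩, ψ, hψ, h2⟩ := hcon
            rcases ha _ ⟨φ, hφ, ψ, hψ, rfl⟩ with h | h
            · exact h1 h
            · exact h2 h)

/-- The ball `d(b)` in `M^x`, where the locality relation `d` on the sort of `x` is given by a
locality relation on the sort of each single variable in `x`. -/
def ball (M : LStructure L) {X : L.Srt → Type u} (d : ∀ s, X s → L.Loc s) (b : Tuple M X) :
    Set (Tuple M X) :=
  {a | ∀ s (i : X s), M.locMap (d s i) (b s i) (a s i)}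

/-! ### Self-maps and automorphisms -/

/-- The set of all (sort-preserving) functions from `M` to itself. -/
def SelfMap (M : LStructure L) : Type u := ∀ s, M.carrier s → M.carrier s

/-- Evaluation of a function at a tuple. -/
def SelfMap.ev {M : LStructure L} {X : L.Srt → Type u} (a : Tuple M X) (f : SelfMap M) :
    Tuple M X :=
  fun s i => f s (a s i)

/-- The pointwise topology on functions: the initial topology from the local positive logic
topology given by the evaluations at finite tuples. -/
instance (M : LStructure L) : TopologicalSpace (SelfMap M) :=
  ⨅ (X : L.Srt → Type u) (_ : Finite (Σ s, X s)) (a : Tuple M X),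
    TopologicalSpace.induced (SelfMap.ev a) (localPositiveLogicTopology M X)

/-- The automorphisms of `M`, as a subgroup of the group of sort-preserving permutations. -/
def autSubgroup (M : LStructure L) : Subgroup (∀ s, Equiv.Perm (M.carrier s)) where
  carrier := {σ | IsHom (M := M) (N := M) (fun s => σ s) ∧
    IsHom (M := M) (N := M) (fun s => (σ s).symm)}
  mul_mem' := by
    rintro σ τ ⟨h1, h2⟩ ⟨h3, h4⟩
    refine ⟨⟨fun R a h => h1.map_rel R _ (h3.map_rel R a h), fun c => ?_,
      fun d a b h => h1.map_loc d _ _ (h3.map_loc d a b h)⟩,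
      ⟨fun R a h => h4.map_rel R _ (h2.map_rel R a h), fun c => ?_,
      fun d a b h => h4.map_loc d _ _ (h2.map_loc d a b h)⟩⟩
    · exact (congrArg (σ _) (h3.map_const c)).trans (h1.map_const c)
    · exact (congrArg (τ _).symm (h2.map_const c)).trans (h4.map_const c)
  one_mem' := ⟨⟨fun _ _ h => h, fun _ => rfl, fun _ _ _ h => h⟩,
    ⟨fun _ _ h => h, fun _ => rfl, fun _ _ _ h => h⟩⟩
  inv_mem' := fun h => ⟨h.2, h.1⟩

/-- The automorphism group of `M`. -/
def Aut (M : LStructure L) : Type u := autSubgroup M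

instance (M : LStructure L) : Group (Aut M) := inferInstanceAs (Group (autSubgroup M))

/-- The underlying function of an automorphism. -/
def Aut.toSelfMap {M : LStructure L} (σ : Aut M) : SelfMap M := fun s a => σ.1 s a

/-- Evaluation of an automorphism at a tuple. -/
def Aut.ev {M : LStructure L} {X : L.Srt → Type u} (a : Tuple M X) (σ : Aut M) : Tuple M X :=
  fun s i => σ.1 s (a s i)

/-- The pointwise topology on `Aut M`: the initial topology from the local positive logic
topology given by the evaluations at finite tuples. -/
instance (M : LStructure L) : TopologicalSpace (Aut M) :=
  ⨅ (X : L.Srt → Type u) (_ : Finite (Σ s, X s)) (a : Tuple M X),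
    TopologicalSpace.induced (Aut.ev a) (localPositiveLogicTopology M X)

/-- The `d`-ball at `a` in `Aut M`, for a choice `d` of a locality relation on each single sort and
a choice `a` of a point in each single sort. -/
def Aut.ball (M : LStructure L) (d : ∀ s, L.Loc s) (a : ∀ s, M.carrier s) : Set (Aut M) :=
  {σ | ∀ s, M.locMap (d s) (a s) (σ.1 s (a s))}

/-! ### Denials, approximations and entourages -/

/-- `T ⊨ ¬ ∃ x, ⋀ Δ ∧ θ`: the formula `θ` and the conjunction of the set of formulas `Δ` are
not jointly satisfied by any tuple in a local model of `T`. -/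
def Perp (T : Set (Sentence L)) {V : L.Srt → Type u} (Δ : Set (Formula L V)) (θ : Formula L V) :
    Prop :=
  ∀ N : LStructure L, IsLocalModel T N → ∀ v : Tuple N V,
    ¬ ((∀ φ ∈ Δ, Formula.Realize φ N v) ∧ Formula.Realize θ N v)

/-- The conjunction of `Δ'` is an approximation to the conjunction of `Δ`: every denial of the
former (a positive formula incompatible with it) is a denial of the latter. -/
def Approximates (T : Set (Sentence L)) {V : L.Srt → Type u} (Δ Δ' : Set (Formula L V)) : Prop :=
  ∀ θ : Formula L V, IsPositive θ → Perp T Δ' θ → Perp T Δ θ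

/-- `ψ` and `φ` are complementary: `φ` approximates every denial of `ψ`. -/
def Complementary (T : Set (Sentence L)) {V : L.Srt → Type u} (ψ φ : Formula L V) : Prop :=
  ∀ θ : Formula L V, IsPositive θ → Perp T {ψ} θ → Approximates T {θ} {φ}

/-- The set of formulas `d(xᵢ, yᵢ)` expressing `d(x, y)`, for a locality relation `d` on the sort
of `x`, given by a locality relation on the sort of each single variable, and `y` a disjoint copy of
`x`. -/
def locFormulas {X : L.Srt → Type u} (d : ∀ s, X s → L.Loc s) :
    Set (Formula L (fun s => X s ⊕ X s)) :=
  {φ | ∃ (s : L.Srt) (i : X s), φ = .loc (d s i) (.free (Sum.inl i)) (.free (Sum.inr i))}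

/-- `(ψ(x, y), φ(x, y))` is an entourage in the locality relation `d`. (The equality `x = y` is
the locality relation `1`.) -/
structure IsEntourage (T : Set (Sentence L)) {X : L.Srt → Type u} (d : ∀ s, X s → L.Loc s)
    (ψ φ : Formula L (fun s => X s ⊕ X s)) : Prop where
  left_localPositive : IsLocalPositive ψ
  right_localPositive : IsLocalPositive φ
  approximates : Approximates T {ψ} (locFormulas d)
  perp_eq : Perp T (locFormulas fun _ _ => 1) φ
  complementary : Complementary T ψ φ

end Semantics

end LocalPositiveLogic

/-! Everything rests on one construction. Take local models `N i` of `T`, an ultrafilter on the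
indices and maps from `R` that induce a homomorphism into the ultraproduct. The elements at finite
distance from the image of `R` form a local model of `T`: local quantifiers cannot leave this part,
so local positive formulas true almost everywhere remain true in it, while positive formulas true in
it are true almost everywhere. The retractor property then sends bounded elements back to `R`,
fixing `R` and preserving local positive formulas (`IsRetractor.exists_retraction`). This acts as a
limit operation.

With all `N i` equal to `R`, it gives limits of ultrafilters in balls of tuples and in balls of `Aut
R`. In the second case the limit is an endomorphism, hence an automorphism by
`IsRetractor.exists_aut`. The same fact makes `Aut R` closed, since being an endomorphism is a
conjunction of atomic conditions on values. With the `N i` realising larger and larger parts of a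
positive diagram, it shows that the failure of a local positive formula in `R` is witnessed by a
denial (`IsRetractor.exists_denial`).

Subbasic closed subsets of `Aut R` have the form `φ(σ(a), b)` with `φ` local positive. Inversion and
translations permute these conditions because automorphisms preserve truth. For the sets of `σ`
mapping `F` into `U`, the complement says that some point of `σ(F)`, which lies in the ball around
the image of the centre, is outside `U`. Compactness of balls reduces this to finitely many formulas
at a time, and each finite case is a local positive condition on `σ`. An entourage makes balls
neighbourhoods of their centres, so a compact set is covered by finitely many of them. -/

namespace LocalPositiveLogic

variable {L : LocalLanguage.{u}} {V W : L.Srt → Type u}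

/-! ### Substitution of terms for free variables -/

/-- A bound variable seen in a context extended at its end. -/
def BVar.castAppend {S : Type u} (Γ' : List S) : ∀ {Γ : List S} {s : S}, BVar Γ s → BVar (Γ ++ Γ') s
  | _ :: _, _, .zero => .zero
  | _ :: _, _, .succ v => .succ (v.castAppend Γ')

/-- A bound variable seen in a context extended at its beginning. -/
def BVar.shift {S : Type u} {Γ' : List S} {s : S} (v : BVar Γ' s) : ∀ Γ : List S, BVar (Γ ++ Γ') s
  | [] => v
  | _ :: Γ => .succ (v.shift Γ)

/-- A term seen in a context of bound variables extended at its beginning. -/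
def Term.shift {Γ' : List L.Srt} {s : L.Srt} (Γ : List L.Srt) :
    Term L V Γ' s → Term L V (Γ ++ Γ') s
  | .free v => .free v
  | .bvar v => .bvar (v.shift Γ)
  | .const c => .const c

/-- Substitution of terms for the free variables in a term. -/
def Term.subst {Γ Γ' : List L.Srt} {s : L.Srt} (ρ : ∀ s, V s → Term L W Γ' s) :
    Term L V Γ s → Term L W (Γ ++ Γ') s
  | .free v => (ρ s v).shift Γ
  | .bvar v => .bvar (v.castAppend Γ')
  | .const c => .const c

/-- Substitution of terms for the free variables in a formula. -/
def BFormula.subst {Γ' : List L.Srt} (ρ : ∀ s, V s → Term L W Γ' s) :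
    ∀ {Γ : List L.Srt}, BFormula L V Γ → BFormula L W (Γ ++ Γ')
  | _, .loc d t t' => .loc d (t.subst ρ) (t'.subst ρ)
  | _, .rel R ts => .rel R fun i => (ts i).subst ρ
  | _, .not φ => .not (φ.subst ρ)
  | _, .and φ ψ => .and (φ.subst ρ) (ψ.subst ρ)
  | _, .or φ ψ => .or (φ.subst ρ) (ψ.subst ρ)
  | _, .ex s φ => .ex s (φ.subst ρ)

/-- Needed for substitution to respect the shape of a local quantifier, whose bounding term is
weakened. -/
theorem Term.subst_weaken {Γ Γ' : List L.Srt} {s r : L.Srt} (ρ : ∀ s, V s → Term L W Γ' s)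
    (t : Term L V Γ s) : (t.weaken r).subst ρ = (t.subst ρ).weaken r := by
  cases t with
  | free v => simp only [Term.weaken, Term.subst]; cases ρ s v <;> rfl
  | bvar v => rfl
  | const c => rfl

theorem IsLocalPositive.subst {Γ' : List L.Srt} (ρ : ∀ s, V s → Term L W Γ' s) {Γ : List L.Srt}
    {φ : BFormula L V Γ} (hφ : IsLocalPositive φ) : IsLocalPositive (φ.subst ρ) := by
  induction hφ with
  | loc d t t' => exact .loc d _ _
  | rel R ts => exact .rel R _
  | and _ _ h1 h2 => exact .and h1 h2
  | or _ _ h1 h2 => exact .or h1 h2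
  | exLoc d t _ h =>
    have := IsLocalPositive.exLoc d (t.subst ρ) h
    simp only [BFormula.exLoc, ← Term.subst_weaken] at this
    exact this

theorem IsPositive.subst {Γ' : List L.Srt} (ρ : ∀ s, V s → Term L W Γ' s) {Γ : List L.Srt}
    {φ : BFormula L V Γ} (hφ : IsPositive φ) : IsPositive (φ.subst ρ) := by
  induction hφ with
  | loc d t t' => exact .loc d _ _
  | rel R ts => exact .rel R _
  | and _ _ h1 h2 => exact .and h1 h2
  | or _ _ h1 h2 => exact .or h1 h2
  | ex _ h => exact .ex h

theorem IsLocalPositive.isPositive {Γ : List L.Srt} {φ : BFormula L V Γ}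
    (hφ : IsLocalPositive φ) : IsPositive φ := by
  induction hφ with
  | loc d t t' => exact .loc d _ _
  | rel R ts => exact .rel R _
  | and _ _ h1 h2 => exact .and h1 h2
  | or _ _ h1 h2 => exact .or h1 h2
  | exLoc d t _ h => exact .ex (.and (.loc _ _ _) h)

theorem consVal_comp {C D : L.Srt → Type u} (f : ∀ s, C s → D s) {Γ : List L.Srt} {s : L.Srt}
    (a : C s) (b : ∀ t, BVar Γ t → C t) :
    (fun t x => f t (consVal a b t x)) = consVal (f s a) (fun t x => f t (b t x)) := by
  funext t x
  cases x <;> rfl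

theorem Term.eval_weaken {Γ : List L.Srt} {s r : L.Srt} (M : LStructure L) (v : Tuple M V)
    (a : M.carrier r) (b : ∀ t, BVar Γ t → M.carrier t) (t : Term L V Γ s) :
    (t.weaken r).eval M v (consVal a b) = t.eval M v b := by
  cases t <;> rfl

theorem BFormula.realizeB_exLoc {Γ : List L.Srt} {s : L.Srt} (M : LStructure L) (v : Tuple M V)
    (b : ∀ t, BVar Γ t → M.carrier t) (d : L.Loc s) (t : Term L V Γ s)
    (φ : BFormula L V (s :: Γ)) :
    (BFormula.exLoc d t φ).RealizeB M v b ↔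
      ∃ a, M.locMap d a (t.eval M v b) ∧ φ.RealizeB M v (consVal a b) :=
  exists_congr fun a =>
    and_congr (iff_of_eq (congrArg (M.locMap d a) (t.eval_weaken M v a b))) Iff.rfl

theorem Term.eval_subst {Γ Γ' : List L.Srt} {s : L.Srt} (ρ : ∀ s, V s → Term L W Γ' s)
    (M : LStructure L) (v : Tuple M W) (b : ∀ t, BVar (Γ ++ Γ') t → M.carrier t)
    (t : Term L V Γ s) :
    (t.subst ρ).eval M v b =
      t.eval M (fun s x => (ρ s x).eval M v fun t y => b t (y.shift Γ))
        (fun t y => b t (y.castAppend Γ')) := by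
  cases t with
  | free v => simp only [Term.subst, Term.eval]; cases ρ s v <;> rfl
  | bvar v => rfl
  | const c => rfl

theorem BFormula.realizeB_subst {Γ' : List L.Srt} (ρ : ∀ s, V s → Term L W Γ' s)
    (M : LStructure L) (v : Tuple M W) {Γ : List L.Srt} (φ : BFormula L V Γ)
    (b : ∀ t, BVar (Γ ++ Γ') t → M.carrier t) :
    (φ.subst ρ).RealizeB M v b ↔
      φ.RealizeB M (fun s x => (ρ s x).eval M v fun t y => b t (y.shift Γ))
        (fun t y => b t (y.castAppend Γ')) := by
  induction φ with
  | loc d t t' => simp only [BFormula.subst, BFormula.RealizeB, Term.eval_subst]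
  | rel R ts => simp only [BFormula.subst, BFormula.RealizeB, Term.eval_subst]
  | not φ ih => simp only [BFormula.subst, BFormula.RealizeB, ih]
  | and φ ψ ih1 ih2 => simp only [BFormula.subst, BFormula.RealizeB, ih1, ih2]
  | or φ ψ ih1 ih2 => simp only [BFormula.subst, BFormula.RealizeB, ih1, ih2]
  | ex s φ ih =>
    simp only [BFormula.subst, BFormula.RealizeB]
    refine exists_congr fun a => ?_
    have h : (fun t y => consVal a b t (BVar.castAppend Γ' y)) =
        consVal a (fun t y => b t (BVar.castAppend Γ' y)) := by
      funext t y
      cases y <;> rfl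
    rw [← h]
    exact ih _

theorem Formula.realize_congr {φ : Formula L V} {M : LStructure L} {v v' : Tuple M V}
    (h : ∀ s x, v s x = v' s x) : φ.Realize M v ↔ φ.Realize M v' :=
  iff_of_eq (congrArg (φ.Realize M) (funext fun s => funext fun x => h s x))

/-- Replacing the free variables in a formula. -/
def Formula.map (ρ : ∀ s, V s → W s) (φ : Formula L V) : Formula L W :=
  BFormula.subst (Γ := []) (Γ' := []) (fun s x => .free (ρ s x)) φ

theorem Formula.realize_map (ρ : ∀ s, V s → W s) (φ : Formula L V) (M : LStructure L)
    (v : Tuple M W) : (φ.map ρ).Realize M v ↔ φ.Realize M (fun s x => v s (ρ s x)) := by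
  unfold Formula.map Formula.Realize
  rw [BFormula.realizeB_subst (Γ := [])]
  refine iff_of_eq (congrArg _ ?_)
  funext t y
  cases y

theorem IsLocalPositive.map (ρ : ∀ s, V s → W s) {φ : Formula L V} (hφ : IsLocalPositive φ) :
    IsLocalPositive (φ.map ρ) := hφ.subst _

/-! ### Quantification over free variables -/

open Classical in
/-- Updating the value of an assignment at a variable. -/
noncomputable def updateVal {C : L.Srt → Type u} (v : ∀ s, V s → C s) {r : L.Srt} (x : V r)
    (a : C r) : ∀ s, V s → C s := fun s y =>
  if h : (⟨r, x⟩ : Σ s, V s) = ⟨s, y⟩ then (show r = s from congrArg Sigma.fst h) ▸ a else v s y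

theorem updateVal_self {C : L.Srt → Type u} (v : ∀ s, V s → C s) {r : L.Srt} (x : V r)
    (a : C r) : updateVal v x a r x = a := by
  simp [updateVal]

theorem updateVal_of_ne {C : L.Srt → Type u} (v : ∀ s, V s → C s) {r : L.Srt} (x : V r)
    (a : C r) {s : L.Srt} (y : V s) (h : (⟨s, y⟩ : Σ s, V s) ≠ ⟨r, x⟩) :
    updateVal v x a s y = v s y := by
  simp [updateVal, h.symm]

theorem updateVal_comp {C D : L.Srt → Type u} (f : ∀ s, C s → D s) (v : ∀ s, V s → C s)
    {r : L.Srt} (x : V r) (a : C r) :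
    (fun s y => f s (updateVal v x a s y)) = updateVal (fun s y => f s (v s y)) x (f r a) := by
  funext s y
  by_cases h : (⟨s, y⟩ : Σ s, V s) = ⟨r, x⟩
  · cases h
    simp only [updateVal_self]
  · simp only [updateVal_of_ne _ _ _ _ h]

/-- Updating a tuple at a variable. -/
noncomputable def Tuple.update {M : LStructure L} (v : Tuple M V) {r : L.Srt} (x : V r)
    (a : M.carrier r) : Tuple M V := updateVal (C := M.carrier) v x a

theorem Tuple.update_self {M : LStructure L} (v : Tuple M V) {r : L.Srt} (x : V r)
    (a : M.carrier r) : v.update x a r x = a := updateVal_self _ _ _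

theorem Tuple.update_of_ne {M : LStructure L} (v : Tuple M V) {r : L.Srt} (x : V r)
    (a : M.carrier r) {s : L.Srt} (y : V s) (h : (⟨s, y⟩ : Σ s, V s) ≠ ⟨r, x⟩) :
    v.update x a s y = v s y := updateVal_of_ne _ _ _ _ h

/-- The concatenation of two tuples. -/
def Tuple.append {M : LStructure L} {X : L.Srt → Type u} (a : Tuple M X) (w : Tuple M W) :
    Tuple M (fun s => X s ⊕ W s) := fun s => Sum.elim (a s) (w s)

theorem Tuple.update_append {M : LStructure L} {X : L.Srt → Type u} (a : Tuple M X)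
    (w : Tuple M W) {r : L.Srt} (x : X r) (e : M.carrier r) :
    (a.append w).update (Sum.inl x) e = (a.update x e).append w := by
  funext s y
  rcases y with y | y
  · by_cases hs : (⟨s, y⟩ : Σ s, X s) = ⟨r, x⟩
    · cases hs
      exact (Tuple.update_self _ _ _).trans (Tuple.update_self _ _ _).symm
    · refine (Tuple.update_of_ne _ _ _ _ fun h => hs ?_).trans
        (Tuple.update_of_ne _ _ _ _ hs).symm
      cases h
      rfl
  · exact Tuple.update_of_ne _ _ _ _ fun h => by cases h

/-- The formula `φ` with the free variable `x` replaced by the last bound variable. -/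
noncomputable def Formula.bindVar {r : L.Srt} (x : V r) (φ : Formula L V) : BFormula L V [r] :=
  BFormula.subst (Γ := []) (updateVal (fun _ y => .free y) x (.bvar .zero)) φ

theorem Formula.realizeB_bindVar {r : L.Srt} (x : V r) (φ : Formula L V) (M : LStructure L)
    (v : Tuple M V) (a : M.carrier r) (b : ∀ t, BVar [] t → M.carrier t) :
    (φ.bindVar x).RealizeB M v (consVal a b) ↔ φ.Realize M (v.update x a) := by
  unfold Formula.bindVar Formula.Realize
  rw [BFormula.realizeB_subst (Γ := [])]
  have h := updateVal_comp (C := Term L V [r]) (D := M.carrier)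
    (fun s t => t.eval M v (consVal a b)) (fun _ y => .free y) x (.bvar .zero)
  refine iff_of_eq ?_
  congr 1
  funext t y
  cases y

/-- The formula `∃ x ∈ d(y), φ`. -/
noncomputable def Formula.exLocVar {r : L.Srt} (d : L.Loc r) (x y : V r) (φ : Formula L V) :
    Formula L V :=
  .exLoc d (.free y) (φ.bindVar x)

theorem Formula.realize_exLocVar {r : L.Srt} (d : L.Loc r) (x y : V r) (φ : Formula L V)
    (M : LStructure L) (v : Tuple M V) :
    (φ.exLocVar d x y).Realize M v ↔
      ∃ a, M.locMap d a (v r y) ∧ φ.Realize M (v.update x a) :=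
  exists_congr fun a => and_congr Iff.rfl (φ.realizeB_bindVar x M v a _)

/-- Only finitely many coordinates of `a` can be quantified away, so the list `l` selects them and
the others stay fixed. The bounding terms are variables on the `W` side, which updates of
`X`-variables leave alone; hence the local quantifiers can be added one after the other. -/
theorem exists_localPositive_exists_agree {X : L.Srt → Type u} (d : ∀ s, X s → L.Loc s)
    (c : ∀ s, X s → W s) (φ : Formula L (fun s => X s ⊕ W s)) (hφ : IsLocalPositive φ)
    (l : List (Σ s, X s)) :
    ∃ θ : Formula L (fun s => X s ⊕ W s), IsLocalPositive θ ∧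
      ∀ (M : LStructure L) (a : Tuple M X) (w : Tuple M W),
        θ.Realize M (a.append w) ↔ ∃ a' : Tuple M X,
          (∀ s (x : X s), ⟨s, x⟩ ∉ l → a' s x = a s x) ∧
          (∀ s (x : X s), ⟨s, x⟩ ∈ l → M.locMap (d s x) (a' s x) (w s (c s x))) ∧
          φ.Realize M (a'.append w) := by
  induction l with
  | nil =>
    refine ⟨φ, hφ, fun M a w => ⟨fun h => ⟨a, fun _ _ _ => rfl, fun _ _ h => by simp at h, h⟩, ?_⟩⟩
    rintro ⟨v', h, -, h'⟩
    have : v' = a := funext fun s => funext fun x => h s x List.not_mem_nil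
    exact this ▸ h'
  | cons z l ih =>
    obtain ⟨r, x⟩ := z
    obtain ⟨θ, hθ, h⟩ := ih
    refine ⟨θ.exLocVar (d r x) (Sum.inl x) (Sum.inr (c r x)), .exLoc _ _ (hθ.subst _),
      fun M a w => ?_⟩
    rw [Formula.realize_exLocVar]
    simp only [Tuple.update_append, h]
    constructor
    · rintro ⟨e, he, a', h1, h2, h3⟩
      refine ⟨a', fun s y hy => ?_, fun s y hy => ?_, h3⟩
      · rw [List.mem_cons, not_or] at hy
        rw [h1 s y hy.2, Tuple.update_of_ne _ _ _ _ hy.1]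
      · by_cases hl : ⟨s, y⟩ ∈ l
        · exact h2 s y hl
        · have hs : (⟨s, y⟩ : Σ s, X s) = ⟨r, x⟩ := (List.mem_cons.1 hy).resolve_right hl
          cases hs
          rw [h1 _ _ hl, Tuple.update_self]
          exact he
    · rintro ⟨a', h1, h2, h3⟩
      refine ⟨a' r x, h2 r x List.mem_cons_self, a', fun s y hy => ?_,
        fun s y hy => h2 s y (List.mem_cons_of_mem _ hy), h3⟩
      by_cases hs : (⟨s, y⟩ : Σ s, X s) = ⟨r, x⟩
      · cases hs
        rw [Tuple.update_self]
      · rw [Tuple.update_of_ne _ _ _ _ hs]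
        exact h1 s y (by simp [hs, hy])

/-! ### Finite supports and finite conjunctions -/

/-- The variables in a set `S` of variables. -/
abbrev RestrictVar (S : Set (Σ s, V s)) (s : L.Srt) : Type u := {x : V s // ⟨s, x⟩ ∈ S}

/-- Allowing every `S'` above `S` lets the parts of a compound formula be restricted to a common
finite set of variables. -/
theorem Term.exists_restrict {Γ : List L.Srt} {s : L.Srt} (t : Term L V Γ s) :
    ∃ S : Set (Σ s, V s), S.Finite ∧ ∀ S', S ⊆ S' → ∃ t' : Term L (RestrictVar S') Γ s,
      ∀ (M : LStructure L) (v : Tuple M V) (b : ∀ t, BVar Γ t → M.carrier t),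
        t'.eval M (fun s x => v s x.1) b = t.eval M v b := by
  cases t with
  | free x =>
    exact ⟨{⟨s, x⟩}, Set.finite_singleton _, fun S' h => ⟨.free ⟨x, h rfl⟩, fun _ _ _ => rfl⟩⟩
  | bvar x => exact ⟨∅, Set.finite_empty, fun S' h => ⟨.bvar x, fun _ _ _ => rfl⟩⟩
  | const c => exact ⟨∅, Set.finite_empty, fun S' h => ⟨.const c, fun _ _ _ => rfl⟩⟩

theorem IsPositive.exists_restrict {Γ : List L.Srt} {φ : BFormula L V Γ} (hφ : IsPositive φ) :
    ∃ S : Set (Σ s, V s), S.Finite ∧ ∀ S', S ⊆ S' → ∃ φ' : BFormula L (RestrictVar S') Γ,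
      IsPositive φ' ∧ ∀ (M : LStructure L) (v : Tuple M V) (b : ∀ t, BVar Γ t → M.carrier t),
        φ'.RealizeB M (fun s x => v s x.1) b ↔ φ.RealizeB M v b := by
  induction hφ with
  | loc d t t' =>
    obtain ⟨S, hS, h⟩ := t.exists_restrict
    obtain ⟨S', hS', h'⟩ := t'.exists_restrict
    refine ⟨S ∪ S', hS.union hS', fun A hA => ?_⟩
    obtain ⟨t₁, h₁⟩ := h A (Set.subset_union_left.trans hA)
    obtain ⟨t₂, h₂⟩ := h' A (Set.subset_union_right.trans hA)
    exact ⟨.loc d t₁ t₂, .loc _ _ _, fun M v b => by simp only [BFormula.RealizeB, h₁, h₂]⟩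
  | rel R ts =>
    choose S hS h using fun i => (ts i).exists_restrict
    refine ⟨⋃ i, S i, Set.finite_iUnion hS, fun A hA => ?_⟩
    choose t' h' using fun i => h i A ((Set.subset_iUnion S i).trans hA)
    exact ⟨.rel R t', .rel _ _, fun M v b => by simp only [BFormula.RealizeB, h']⟩
  | and _ _ ih1 ih2 =>
    obtain ⟨S, hS, h⟩ := ih1
    obtain ⟨S', hS', h'⟩ := ih2
    refine ⟨S ∪ S', hS.union hS', fun A hA => ?_⟩
    obtain ⟨t₁, p₁, h₁⟩ := h A (Set.subset_union_left.trans hA)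
    obtain ⟨t₂, p₂, h₂⟩ := h' A (Set.subset_union_right.trans hA)
    exact ⟨.and t₁ t₂, .and p₁ p₂, fun M v b => and_congr (h₁ M v b) (h₂ M v b)⟩
  | or _ _ ih1 ih2 =>
    obtain ⟨S, hS, h⟩ := ih1
    obtain ⟨S', hS', h'⟩ := ih2
    refine ⟨S ∪ S', hS.union hS', fun A hA => ?_⟩
    obtain ⟨t₁, p₁, h₁⟩ := h A (Set.subset_union_left.trans hA)
    obtain ⟨t₂, p₂, h₂⟩ := h' A (Set.subset_union_right.trans hA)
    exact ⟨.or t₁ t₂, .or p₁ p₂, fun M v b => or_congr (h₁ M v b) (h₂ M v b)⟩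
  | ex _ ih =>
    obtain ⟨S, hS, h⟩ := ih
    refine ⟨S, hS, fun A hA => ?_⟩
    obtain ⟨t₁, p₁, h₁⟩ := h A hA
    exact ⟨.ex _ t₁, .ex p₁, fun M v b => exists_congr fun a => h₁ M v _⟩

theorem Formula.exists_support {φ : Formula L V} (hφ : IsPositive φ) :
    ∃ S : Set (Σ s, V s), S.Finite ∧ ∀ (M : LStructure L) (v v' : Tuple M V),
      (∀ s (x : V s), ⟨s, x⟩ ∈ S → v s x = v' s x) → (φ.Realize M v ↔ φ.Realize M v') := by
  obtain ⟨S, hS, h⟩ := hφ.exists_restrict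
  obtain ⟨φ', -, h'⟩ := h S subset_rfl
  refine ⟨S, hS, fun M v v' hv => (h' M v _).symm.trans (Iff.trans (iff_of_eq ?_) (h' M v' _))⟩
  congr 1
  funext s x
  exact hv s x.1 x.2

/-! ### Quantification over a set of variables -/

theorem IsPositive.exists_realize_iff_exists_bound {Γ : List L.Srt} {φ : BFormula L V Γ}
    (hφ : IsPositive φ) : ∃ θ : Formula L V, IsPositive θ ∧ ∀ (M : LStructure L) (v : Tuple M V),
      θ.Realize M v ↔ ∃ b, φ.RealizeB M v b := by
  induction Γ with
  | nil =>
    refine ⟨φ, hφ, fun M v => ⟨fun h => ⟨_, h⟩, ?_⟩⟩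
    rintro ⟨b, hb⟩
    refine (iff_of_eq ?_).1 hb
    change BFormula.RealizeB _ _ _ _ = BFormula.RealizeB _ _ _ _
    congr 1
    funext s x
    cases x
  | cons s Γ ih =>
    obtain ⟨θ, hθ, h⟩ := ih hφ.ex
    refine ⟨θ, hθ, fun M v => (h M v).trans ⟨fun ⟨b, a, hab⟩ => ⟨_, hab⟩, ?_⟩⟩
    rintro ⟨b, hb⟩
    refine ⟨fun t x => b t x.succ, b s .zero, (iff_of_eq ?_).1 hb⟩
    congr 1
    funext t x
    cases x <;> rfl

/-- The variable at a given position in a list of variables. -/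
def BVar.lookup : ∀ (l : List (Σ s, V s)) (t : L.Srt), BVar (l.map Sigma.fst) t → V t
  | ⟨_, x⟩ :: _, _, .zero => x
  | _ :: l, t, .succ w => BVar.lookup l t w

theorem BVar.exists_lookup (l : List (Σ s, V s)) (t : L.Srt) (x : V t) (hx : ⟨t, x⟩ ∈ l) :
    ∃ w, BVar.lookup l t w = x := by
  induction l with
  | nil => simp at hx
  | cons z l ih =>
    rcases List.mem_cons.1 hx with rfl | h
    · exact ⟨.zero, rfl⟩
    · obtain ⟨w, hw⟩ := ih h
      exact ⟨.succ w, hw⟩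

/-- There may be infinitely many variables in `W`, but only the finitely many that occur in `φ` need
a quantifier. The quantifiers are not local, so the result is merely positive; this is enough for
denials. -/
theorem IsPositive.exists_realize_iff_exists_append {φ : Formula L (fun s => V s ⊕ W s)}
    (hφ : IsPositive φ) : ∃ θ : Formula L V, IsPositive θ ∧ ∀ (M : LStructure L) (a : Tuple M V),
      θ.Realize M a ↔ ∃ w : Tuple M W, φ.Realize M (a.append w) := by
  classical
  obtain ⟨S, hS, h⟩ := hφ.exists_restrict
  obtain ⟨φ', hφ', h'⟩ := h S subset_rfl
  let l : List (Σ s, W s) := (hS.preimage (f := fun y : Σ s, W s =>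
    (⟨y.1, Sum.inr y.2⟩ : Σ s, V s ⊕ W s)) (by
      rintro ⟨s, x⟩ - ⟨t, y⟩ - hxy
      cases hxy
      rfl)).toFinset.toList
  have hl : ∀ s (y : W s), ⟨s, Sum.inr y⟩ ∈ S → ⟨s, y⟩ ∈ l := fun s y hy => by
    simp only [l, Finset.mem_toList, Set.Finite.mem_toFinset]
    exact hy
  choose e he using fun s (y : W s) (hy : ⟨s, Sum.inr y⟩ ∈ S) =>
    BVar.exists_lookup l s y (hl s y hy)
  let ρ : ∀ s, RestrictVar S s → Term L V (l.map Sigma.fst) s := fun s x =>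
    match x with
    | ⟨.inl x, _⟩ => .free x
    | ⟨.inr y, hy⟩ => .bvar (e s y hy)
  obtain ⟨θ, hθ, H⟩ := (hφ'.subst ρ).exists_realize_iff_exists_bound
  refine ⟨θ, hθ, fun M a => (H M a).trans ⟨?_, ?_⟩⟩
  · rintro ⟨b, hb⟩
    rw [BFormula.realizeB_subst ρ M a (Γ := [])] at hb
    -- Variables not occurring in `φ` take an arbitrary value, which exists because sorts are
    -- non-empty.
    refine ⟨fun s y => if hy : ⟨s, Sum.inr y⟩ ∈ S then b s (e s y hy) else (M.nonempty s).some,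
      (h' M _ _).1 ((iff_of_eq ?_).1 hb)⟩
    congr 1
    · funext s x
      obtain ⟨x | y, hx⟩ := x
      · rfl
      · change _ = dite _ _ _
        rw [dif_pos hx]
        rfl
    · funext s x
      cases x
  · rintro ⟨w, hw⟩
    refine ⟨fun t x => w t (BVar.lookup l t x), ?_⟩
    rw [BFormula.realizeB_subst ρ M a (Γ := [])]
    refine (iff_of_eq ?_).1 ((h' M _ _).2 hw)
    congr 1
    · funext s x
      obtain ⟨x | y, hx⟩ := x
      · rfl
      · exact congrArg (w s) (he s y hx).symm
    · funext s x
      cases x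

/-- The empty conjunction is kept apart: without variables or constants there may be no true local
positive formula to express it. -/
theorem exists_localPositive_forall_mem {J : Type*} (χ : J → Formula L V)
    (hχ : ∀ j, IsLocalPositive (χ j)) (F : Finset J) :
    F = ∅ ∨ ∃ φ : Formula L V, IsLocalPositive φ ∧ ∀ (M : LStructure L) (v : Tuple M V),
      φ.Realize M v ↔ ∀ j ∈ F, (χ j).Realize M v := by
  classical
  induction F using Finset.induction_on with
  | empty => exact Or.inl rfl
  | insert j F _ ih =>
    right
    rcases ih with rfl | ⟨φ, hφ, h⟩
    · exact ⟨χ j, hχ j, fun M v => by simp⟩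
    · refine ⟨.and (χ j) φ, .and (hχ j) hφ, fun M v => ?_⟩
      rw [Finset.forall_mem_insert, ← h M v]
      rfl

end LocalPositiveLogic

namespace LocalPositiveLogic

variable {L : LocalLanguage.{u}} {V : L.Srt → Type u}

/-! ### Local ultraproducts -/

section Ultraproduct

variable {I : Type u} (𝒰 : Ultrafilter I) (R : LStructure L) (N : I → LStructure L)
  (h : ∀ s, R.carrier s → ∀ i, (N i).carrier s)

/-- A family of maps `R → N i` which preserves each atomic fact for almost all `i`, that is, one
which induces a homomorphism from `R` to the ultraproduct. -/
structure IsAlmostHom : Prop where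
  map_rel : ∀ {l : List L.Srt} (Q : L.Rel l) (a : ∀ i : Fin l.length, R.carrier (l.get i)),
    R.relMap Q a → ∀ᶠ i in 𝒰, (N i).relMap Q (fun j => h _ (a j) i)
  map_const : ∀ {s : L.Srt} (c : L.Const s), ∀ᶠ i in 𝒰, h s (R.constMap c) i = (N i).constMap c
  map_loc : ∀ {s : L.Srt} (d : L.Loc s) (a b : R.carrier s),
    R.locMap d a b → ∀ᶠ i in 𝒰, (N i).locMap d (h s a i) (h s b i)

/-- The elements of the product of the structures `N i` at finite distance, in the ultraproduct,
from the image of `R`. -/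
def BoundedElem (s : L.Srt) : Type u :=
  {a : ∀ i, (N i).carrier s //
    ∃ (r : R.carrier s) (d : L.Loc s), ∀ᶠ i in 𝒰, (N i).locMap d (h s r i) (a i)}

/-- Almost everywhere equality. -/
instance boundedElemSetoid (s : L.Srt) : Setoid (BoundedElem 𝒰 R N h s) where
  r a b := ∀ᶠ i in 𝒰, a.1 i = b.1 i
  iseqv := ⟨fun _ => .of_forall fun _ => rfl, fun h => h.mono fun _ h => h.symm,
    fun h1 h2 => (h1.and h2).mono fun _ h => h.1.trans h.2⟩

variable {R N h 𝒰}

theorem LStructure.IsLocal.loc_self {M : LStructure L} (hM : M.IsLocal) {s : L.Srt} (d : L.Loc s)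
    (a : M.carrier s) : M.locMap d a a :=
  hM.mono 1 d (L.one_le_loc d) _ _ ((M.locMap_one a a).2 rfl)

/-- The image of an element of `R`. -/
def IsAlmostHom.base (hh : IsAlmostHom 𝒰 R N h) {s : L.Srt} (r : R.carrier s) :
    BoundedElem 𝒰 R N h s :=
  ⟨h s r, r, 1, hh.map_loc 1 r r ((R.locMap_one r r).2 rfl)⟩

/-- The local part, around the image of `R`, of the ultraproduct. -/
noncomputable def localUltraproduct (hh : IsAlmostHom 𝒰 R N h) : LStructure L where
  carrier s := Quotient (boundedElemSetoid 𝒰 R N h s)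
  nonempty s := (R.nonempty s).map fun r => ⟦hh.base r⟧
  -- The chosen representatives do not matter: any two agree almost everywhere, and `Q` has finitely
  -- many arguments.
  relMap Q a := ∀ᶠ i in 𝒰, (N i).relMap Q fun j => (a j).out.1 i
  constMap c := ⟦⟨fun i => (N i).constMap c, R.constMap c, 1, (hh.map_const c).mono fun i hi =>
    ((N i).locMap_one _ _).2 hi⟩⟧
  locMap d a b := ∀ᶠ i in 𝒰, (N i).locMap d (a.out.1 i) (b.out.1 i)
  locMap_one a b := by
    simp only [LStructure.locMap_one]
    exact ⟨fun h => Quotient.out_equiv_out.1 h, fun h => h ▸ .of_forall fun _ => rfl⟩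

variable (hh : IsAlmostHom 𝒰 R N h)

/-- The class of a bounded element. -/
def IsAlmostHom.toQuot {s : L.Srt} (a : BoundedElem 𝒰 R N h s) : (localUltraproduct hh).carrier s :=
  Quotient.mk _ a

theorem IsAlmostHom.out_toQuot {s : L.Srt} (a : BoundedElem 𝒰 R N h s) :
    ∀ᶠ i in 𝒰, (Quotient.out (hh.toQuot a)).1 i = a.1 i :=
  Quotient.mk_out a

theorem IsAlmostHom.exists_toQuot {s : L.Srt} (a : (localUltraproduct hh).carrier s) :
    ∃ a', hh.toQuot a' = a := Quotient.exists_rep a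

theorem IsAlmostHom.locMap_toQuot {s : L.Srt} (d : L.Loc s) (a b : BoundedElem 𝒰 R N h s) :
    (localUltraproduct hh).locMap d (hh.toQuot a) (hh.toQuot b) ↔
      ∀ᶠ i in 𝒰, (N i).locMap d (a.1 i) (b.1 i) := by
  refine Filter.eventually_congr ?_
  filter_upwards [hh.out_toQuot a, hh.out_toQuot b] with i h1 h2
  rw [h1, h2]

/-- All axioms but the last pass to the ultraproduct coordinatewise. The last may fail in a full
ultraproduct; here two elements are joined by a path through points of `R` near each of them. -/
theorem localUltraproduct_isLocal (hR : R.IsLocal) (hN : ∀ i, (N i).IsLocal) : (localUltraproduct hh).IsLocal where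
  symm d a b h := h.mono fun i hi => (hN i).symm d _ _ hi
  mono d₁ d₂ hd a b h := h.mono fun i hi => (hN i).mono d₁ d₂ hd _ _ hi
  comp d₁ d₂ a b c h1 h2 := (h1.and h2).mono fun i hi => (hN i).comp d₁ d₂ _ _ _ hi.1 hi.2
  bound c₁ c₂ := (hh.locMap_toQuot _ _ _).2 (.of_forall fun i => (hN i).bound c₁ c₂)
  exists_loc a b := by
    obtain ⟨r, d, hr⟩ := a.out.2
    obtain ⟨r', d', hr'⟩ := b.out.2
    obtain ⟨e, he⟩ := hR.exists_loc r r'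
    refine ⟨d * e * d', ?_⟩
    filter_upwards [hr, hr', hh.map_loc e r r' he] with i h1 h2 h3
    exact (hN i).comp _ _ _ _ _ ((hN i).comp _ _ _ _ _ ((hN i).symm _ _ _ h1) h3) h2

theorem IsAlmostHom.out_eval (v : ∀ s, V s → BoundedElem 𝒰 R N h s) {Γ : List L.Srt}
    (b : ∀ t, BVar Γ t → BoundedElem 𝒰 R N h t) {s : L.Srt} (t : Term L V Γ s) :
    ∀ᶠ i in 𝒰, (Quotient.out (t.eval (localUltraproduct hh) (fun s x => hh.toQuot (v s x))
      (fun s x => hh.toQuot (b s x)))).1 i =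
        t.eval (N i) (fun s x => (v s x).1 i) (fun s x => (b s x).1 i) := by
  cases t with
  | free x => exact hh.out_toQuot _
  | bvar x => exact hh.out_toQuot _
  | const c => exact hh.out_toQuot _

theorem consVal_val (i : I) {Γ : List L.Srt} {s : L.Srt} (a : BoundedElem 𝒰 R N h s)
    (b : ∀ t, BVar Γ t → BoundedElem 𝒰 R N h t) :
    (fun t x => (consVal a b t x).1 i) = consVal (a.1 i) fun t x => (b t x).1 i :=
  consVal_comp (D := (N i).carrier) (fun _ e => e.1 i) a b

theorem consVal_toQuot {Γ : List L.Srt} {s : L.Srt} (a : BoundedElem 𝒰 R N h s)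
    (b : ∀ t, BVar Γ t → BoundedElem 𝒰 R N h t) :
    (fun t x => hh.toQuot (consVal a b t x)) = consVal (hh.toQuot a) fun t x => hh.toQuot (b t x) :=
  consVal_comp (D := (localUltraproduct hh).carrier) (fun _ e => hh.toQuot e) a b

/-- Positive formulas true in the local ultraproduct are true almost everywhere. -/
theorem eventually_realize_of_localUltraproduct (v : ∀ s, V s → BoundedElem 𝒰 R N h s)
    {Γ : List L.Srt} {φ : BFormula L V Γ} (hφ : IsPositive φ)
    (b : ∀ t, BVar Γ t → BoundedElem 𝒰 R N h t)
    (H : φ.RealizeB (localUltraproduct hh) (fun s x => hh.toQuot (v s x)) fun s x => hh.toQuot (b s x)) :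
    ∀ᶠ i in 𝒰, φ.RealizeB (N i) (fun s x => (v s x).1 i) fun s x => (b s x).1 i := by
  induction hφ with
  | loc d t t' =>
    filter_upwards [H, hh.out_eval v b t, hh.out_eval v b t'] with i h1 h2 h3
    rwa [h2, h3] at h1
  | rel Q ts =>
    filter_upwards [H, Filter.eventually_all.2 fun j => hh.out_eval v b (ts j)] with i h1 h2
    simp only [h2] at h1
    exact h1
  | and _ _ h1 h2 => exact (h1 b H.1).and (h2 b H.2)
  | or _ _ h1 h2 =>
    exact H.elim (fun H => (h1 b H).mono fun _ => Or.inl) fun H => (h2 b H).mono fun _ => Or.inr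
  | ex _ ih =>
    obtain ⟨a, ha⟩ := H
    obtain ⟨a, rfl⟩ := hh.exists_toQuot a
    rw [← consVal_toQuot] at ha
    filter_upwards [ih (consVal a b) ha] with i hi
    rw [consVal_val] at hi
    exact ⟨_, hi⟩

/-- Local positive formulas true almost everywhere are true in the local ultraproduct. -/
theorem localUltraproduct_realize (hN : ∀ i, (N i).IsLocal)
    (v : ∀ s, V s → BoundedElem 𝒰 R N h s) {Γ : List L.Srt} {φ : BFormula L V Γ}
    (hφ : IsLocalPositive φ) (b : ∀ t, BVar Γ t → BoundedElem 𝒰 R N h t)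
    (H : ∀ᶠ i in 𝒰, φ.RealizeB (N i) (fun s x => (v s x).1 i) fun s x => (b s x).1 i) :
    φ.RealizeB (localUltraproduct hh) (fun s x => hh.toQuot (v s x)) fun s x => hh.toQuot (b s x) := by
  induction hφ with
  | loc d t t' =>
    change ∀ᶠ i in (𝒰 : Filter I), _
    filter_upwards [H, hh.out_eval v b t, hh.out_eval v b t'] with i h1 h2 h3
    rwa [h2, h3]
  | rel Q ts =>
    change ∀ᶠ i in (𝒰 : Filter I), _
    filter_upwards [H, Filter.eventually_all.2 fun j => hh.out_eval v b (ts j)] with i h1 h2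
    simp only [h2]
    exact h1
  | and _ _ h1 h2 =>
    exact ⟨h1 b (H.mono fun _ => And.left), h2 b (H.mono fun _ => And.right)⟩
  | or _ _ h1 h2 =>
    exact (Ultrafilter.eventually_or.1 H).imp (h1 b) (h2 b)
  | @exLoc Γ s d t φ _ ih =>
    obtain ⟨r, e, hr⟩ := (Quotient.out (t.eval (localUltraproduct hh) (fun s x => hh.toQuot (v s x))
      (fun s x => hh.toQuot (b s x)))).2
    obtain ⟨a, ha⟩ : ∃ a : ∀ i, (N i).carrier s, ∀ᶠ i in 𝒰,
        (N i).locMap d (a i) (t.eval (N i) (fun s x => (v s x).1 i) fun s x => (b s x).1 i) ∧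
        φ.RealizeB (N i) (fun s x => (v s x).1 i) (consVal (a i) fun s x => (b s x).1 i) := by
      -- A witness is chosen wherever there is one; the junk values elsewhere occupy a null set.
      refine ⟨fun i => @Classical.epsilon _ ((N i).nonempty s) fun a =>
        (N i).locMap d a (t.eval (N i) (fun s x => (v s x).1 i) fun s x => (b s x).1 i) ∧
        φ.RealizeB (N i) (fun s x => (v s x).1 i) (consVal a fun s x => (b s x).1 i),
        H.mono fun i hi => ?_⟩
      exact Classical.epsilon_spec ((BFormula.realizeB_exLoc _ _ _ _ _ _).1 hi)
    -- Locality of the quantifier is used here: the bounding term lies within `e` of the image of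
    -- `r`, so the witness lies within `e * d` and belongs to the bounded part.
    have ha' : ∃ (r : R.carrier s) (d : L.Loc s), ∀ᶠ i in 𝒰, (N i).locMap d (h s r i) (a i) := by
      refine ⟨r, e * d, ?_⟩
      filter_upwards [hr, ha, hh.out_eval v b t] with i h1 h2 h3
      rw [h3] at h1
      exact (hN i).comp _ _ _ _ _ h1 ((hN i).symm _ _ _ h2.1)
    let A : BoundedElem 𝒰 R N h s := ⟨a, ha'⟩
    refine (BFormula.realizeB_exLoc _ _ _ _ _ _).2 ⟨hh.toQuot A, ?_, ?_⟩
    · change ∀ᶠ i in (𝒰 : Filter I), _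
      filter_upwards [ha, hh.out_eval v b t, hh.out_toQuot A] with i h1 h2 h3
      rw [h2]
      exact h3.symm ▸ h1.1
    · rw [← consVal_toQuot]
      refine ih (consVal A b) ?_
      filter_upwards [ha] with i hi
      rw [consVal_val]
      exact hi.2

/-- A positive sentence true in the local ultraproduct is true in some `N i`, so it cannot be one
that `T` negates. -/
theorem localUltraproduct_isLocalModel {T : Set (Sentence L)} (hT : ∀ φ ∈ T, IsNegative φ)
    (hR : R.IsLocal) (hN : ∀ i, IsLocalModel T (N i)) : IsLocalModel T (localUltraproduct hh) := by
  refine ⟨localUltraproduct_isLocal hh hR fun i => (hN i).1, fun φ hφ => ?_⟩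
  obtain ⟨ψ, hψ, rfl⟩ := hT φ hφ
  intro H
  have := eventually_realize_of_localUltraproduct hh (fun _ x => nomatch x) hψ
    (fun _ x => nomatch x) (by
      refine (iff_of_eq ?_).1 H
      congr 1
      · funext s x; cases x
      · funext s x; cases x)
  obtain ⟨i, hi⟩ := this.exists
  refine (hN i).2 _ hφ ((iff_of_eq ?_).1 hi)
  congr 1
  · funext s x; cases x
  · funext s x; cases x

end Ultraproduct

/-! ### Retractors -/

theorem IsHom.eval {M N : LStructure L} {f : ∀ s, M.carrier s → N.carrier s} (hf : IsHom f)
    {Γ : List L.Srt} (v : Tuple M V) (b : ∀ t, BVar Γ t → M.carrier t) {s : L.Srt}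
    (t : Term L V Γ s) :
    f s (t.eval M v b) = t.eval N (fun s x => f s (v s x)) fun s x => f s (b s x) := by
  cases t with
  | free x => rfl
  | bvar x => rfl
  | const c => exact hf.map_const c

theorem IsHom.realizeB {M N : LStructure L} {f : ∀ s, M.carrier s → N.carrier s} (hf : IsHom f)
    (v : Tuple M V) {Γ : List L.Srt} {φ : BFormula L V Γ} (hφ : IsPositive φ)
    (b : ∀ t, BVar Γ t → M.carrier t) (H : φ.RealizeB M v b) :
    φ.RealizeB N (fun s x => f s (v s x)) fun s x => f s (b s x) := by
  induction hφ with
  | loc d t t' =>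
    have := hf.map_loc d _ _ H
    rwa [hf.eval, hf.eval] at this
  | rel Q ts =>
    have := hf.map_rel Q _ H
    simp only [hf.eval] at this
    exact this
  | and _ _ h1 h2 => exact ⟨h1 b H.1, h2 b H.2⟩
  | or _ _ h1 h2 => exact H.imp (h1 b) (h2 b)
  | ex _ ih =>
    obtain ⟨a, ha⟩ := H
    have := ih _ ha
    rw [consVal_comp] at this
    exact ⟨_, this⟩

theorem IsHom.realize {M N : LStructure L} {f : ∀ s, M.carrier s → N.carrier s} (hf : IsHom f)
    (v : Tuple M V) {φ : Formula L V} (hφ : IsPositive φ) (H : φ.Realize M v) :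
    φ.Realize N fun s x => f s (v s x) := by
  refine (iff_of_eq ?_).1 (hf.realizeB v hφ _ H)
  change BFormula.RealizeB _ _ _ _ = BFormula.RealizeB _ _ _ _
  congr 1
  funext s x; cases x

/-- Bounded elements of an ultraproduct along an almost homomorphism from a retractor retract onto
it, preserving the local positive formulas which hold almost everywhere. -/
theorem IsRetractor.exists_retraction {T : Set (Sentence L)} (hT : ∀ φ ∈ T, IsNegative φ)
    {R : LStructure L} (hR : IsRetractor T R) {I : Type u} (𝒰 : Ultrafilter I)
    (N : I → LStructure L) (hN : ∀ i, IsLocalModel T (N i))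
    (h : ∀ s, R.carrier s → ∀ i, (N i).carrier s) (hh : IsAlmostHom 𝒰 R N h) :
    ∃ g : ∀ s, BoundedElem 𝒰 R N h s → R.carrier s,
      (∀ s (r : R.carrier s), g s (hh.base r) = r) ∧
      ∀ {V : L.Srt → Type u} (v : ∀ s, V s → BoundedElem 𝒰 R N h s) (φ : Formula L V),
        IsLocalPositive φ → (∀ᶠ i in 𝒰, φ.Realize (N i) fun s x => (v s x).1 i) →
          φ.Realize R fun s x => g s (v s x) := by
  have hf : IsHom (M := R) (N := localUltraproduct hh) fun s r => hh.toQuot (hh.base r) := by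
    refine ⟨fun Q a H => ?_, fun c => Quotient.sound (hh.map_const c),
      fun d a b H => (hh.locMap_toQuot _ _ _).2 (hh.map_loc d a b H)⟩
    change ∀ᶠ i in (𝒰 : Filter I), _
    filter_upwards [hh.map_rel Q a H,
      Filter.eventually_all.2 fun j => hh.out_toQuot (hh.base (a j))] with i h1 h2
    simp only [h2]
    exact h1
  obtain ⟨g, hg, hgf⟩ := hR.2 _ (localUltraproduct_isLocalModel hh hT hR.1.1 hN) _ hf
  refine ⟨fun s a => g s (hh.toQuot a), hgf, fun v φ hφ H => ?_⟩
  refine hg.realize _ hφ.isPositive ((iff_of_eq ?_).1 (localUltraproduct_realize hh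
    (fun i => (hN i).1) v hφ (fun _ x => nomatch x) (H.mono fun i hi => (iff_of_eq ?_).1 hi)))
  · change BFormula.RealizeB _ _ _ _ = BFormula.RealizeB _ _ _ _
    congr 1
    funext s x; cases x
  · change BFormula.RealizeB _ _ _ _ = BFormula.RealizeB _ _ _ _
    congr 1
    funext s x; cases x

/-- Every endomorphism of a retractor is an automorphism. -/
theorem IsRetractor.exists_aut {T : Set (Sentence L)} {R : LStructure L} (hR : IsRetractor T R)
    (f : ∀ s, R.carrier s → R.carrier s) (hf : IsHom (M := R) (N := R) f) :
    ∃ σ : Aut R, σ.toSelfMap = f := by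
  obtain ⟨g, hg, hgf⟩ := hR.2 R hR.1 f hf
  obtain ⟨g', hg', hgg⟩ := hR.2 R hR.1 g hg
  -- The retraction `g` of `f` is injective, since it has the retraction `g'`, and it takes the same
  -- value at `f (g a)` and `a`.
  have hfg : ∀ s a, f s (g s a) = a := fun s a => by
    rw [← hgg s (f s (g s a)), hgf, hgg]
  exact ⟨⟨fun s => ⟨f s, g s, hgf s, hfg s⟩, hf, hg⟩, rfl⟩

end LocalPositiveLogic

namespace LocalPositiveLogic

variable {L : LocalLanguage.{u}} {X V W : L.Srt → Type u} {R : LStructure L}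

/-! ### Closed sets and limits in the local positive logic topology -/

theorem Tuple.isClosed_iff {D : Set (Tuple R X)} :
    IsClosed D ↔ D = ∅ ∨ IsLocalPositiveTypeDefinable D := by
  rw [← isOpen_compl_iff]
  change Dᶜᶜ ∈ {D | D = ∅ ∨ IsLocalPositiveTypeDefinable D} ↔ _
  rw [compl_compl]
  rfl

/-- A set of tuples defined by a local positive formula is closed. -/
theorem isClosed_setOf_realize {φ : Formula L (fun s => X s ⊕ W s)} (hφ : IsLocalPositive φ)
    (w : Tuple R W) : IsClosed {a : Tuple R X | φ.Realize R (a.append w)} := by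
  refine Tuple.isClosed_iff.2 (Or.inr ⟨{φ.map fun s => Sum.map id (w s)}, ?_, ?_⟩)
  · rintro _ rfl
    exact hφ.map _
  · ext a
    simp only [Set.mem_ofPred_eq, Set.mem_singleton_iff, forall_eq]
    refine Iff.trans (Formula.realize_congr fun s x => ?_) (Formula.realize_map _ φ R _).symm
    rcases x with x | x <;> rfl

theorem Tuple.isClosed_ball (d : ∀ s, X s → L.Loc s) (b : Tuple R X) :
    IsClosed (ball R d b) := by
  have : ball R d b = ⋂ (s) (i : X s), {a : Tuple R X | Formula.Realize
      (.loc (d s i) (.free (Sum.inr i)) (.free (Sum.inl i))) R (a.append b)} := by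
    ext a
    simp only [Set.mem_iInter]
    rfl
  rw [this]
  exact isClosed_iInter fun s => isClosed_iInter fun i => isClosed_setOf_realize (.loc _ _ _) b

/-- If the ultrafilter missed an open set around `c`, it would contain the closed complement. The
formulas defining that complement would hold almost everywhere, hence at `c`. -/
theorem Tuple.ultrafilter_le_nhds {𝒰 : Ultrafilter (Tuple R X)} {c : Tuple R X}
    (h : ∀ φ : PFormula R X, IsLocalPositive φ → (∀ᶠ a in 𝒰, φ.Realize a) → φ.Realize c) :
    (𝒰 : Filter (Tuple R X)) ≤ nhds c := by
  intro U hU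
  obtain ⟨O, hOU, hO, hc⟩ := mem_nhds_iff.1 hU
  refine Filter.mem_of_superset ?_ hOU
  by_contra hO'
  have hO' : Oᶜ ∈ 𝒰 := Ultrafilter.compl_mem_iff_notMem.2 hO'
  rcases Tuple.isClosed_iff.1 hO.isClosed_compl with h0 | ⟨Δ, hΔ, h0⟩
  · rw [h0] at hO'
    exact Ultrafilter.empty_notMem hO'
  · have : c ∈ Oᶜ := by
      rw [h0] at hO' ⊢
      exact fun φ hφ => h φ (hΔ φ hφ) (Filter.mem_of_superset hO' fun a ha => ha φ hφ)
    exact this hc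

/-! ### The pointwise topology -/

/-- The tuple of the values of a self-map, together with all the elements of the structure. -/
def SelfMap.graph (f : SelfMap R) : Tuple R (fun s => R.carrier s ⊕ R.carrier s) :=
  Tuple.append (M := R) (X := R.carrier) (W := R.carrier) f fun _ a => a

theorem SelfMap.continuous_ev [Finite (Σ s, X s)] (a : Tuple R X) : Continuous (SelfMap.ev a) :=
  continuous_iff_le_induced.2 (iInf_le_of_le X (iInf_le_of_le ‹_› (iInf_le_of_le a le_rfl)))

/-- A formula involves finitely many values of `f`, so the set is the preimage of a closed set under
evaluation at a single finite tuple. -/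
theorem SelfMap.isClosed_setOf_realize {φ : Formula L (fun s => R.carrier s ⊕ R.carrier s)}
    (hφ : IsLocalPositive φ) : IsClosed {f : SelfMap R | φ.Realize R f.graph} := by
  classical
  obtain ⟨S, hS, h⟩ := Formula.exists_support hφ.isPositive
  let Y : L.Srt → Type u := fun s => {x : R.carrier s // (⟨s, Sum.inl x⟩ : Σ s, R.carrier s ⊕ R.carrier s) ∈ S}
  have hY : Finite (Σ s, Y s) := by
    have := hS.to_subtype
    refine Finite.of_injective (β := S) (fun y => ⟨⟨y.1, Sum.inl y.2.1⟩, y.2.2⟩) ?_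
    rintro ⟨s, x, hx⟩ ⟨t, y, hy⟩ hxy
    cases hxy
    rfl
  let ρ : ∀ s, R.carrier s ⊕ R.carrier s → Y s ⊕ R.carrier s := fun s x =>
    match x with
    -- Variables outside the support may be sent anywhere of the right sort.
    | .inl x => if hx : (⟨s, Sum.inl x⟩ : Σ s, R.carrier s ⊕ R.carrier s) ∈ S then .inl ⟨x, hx⟩ else .inr x
    | .inr x => .inr x
  let a : Tuple R Y := fun s y => y.1
  have key : {f : SelfMap R | φ.Realize R f.graph} = SelfMap.ev a ⁻¹'
      {c | Formula.Realize (φ.map ρ) R (c.append (W := R.carrier) fun _ m => m)} := by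
    ext f
    refine Iff.trans (h R _ _ fun s x hx => ?_) (Formula.realize_map _ φ R _).symm
    rcases x with x | x
    · simp only [ρ, dif_pos hx]
      rfl
    · rfl
  rw [key]
  exact (LocalPositiveLogic.isClosed_setOf_realize (hφ.map ρ) _).preimage
    (SelfMap.continuous_ev a)

theorem Aut.isInducing_toSelfMap :
    Topology.IsInducing (Aut.toSelfMap : Aut R → SelfMap R) := by
  constructor
  change (⨅ _, _) = TopologicalSpace.induced _ (⨅ _, _)
  simp only [induced_iInf, induced_compose]
  rfl

theorem Aut.isClosed_setOf_realize {φ : Formula L (fun s => R.carrier s ⊕ R.carrier s)}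
    (hφ : IsLocalPositive φ) : IsClosed {σ : Aut R | φ.Realize R σ.toSelfMap.graph} :=
  (SelfMap.isClosed_setOf_realize hφ).preimage Aut.isInducing_toSelfMap.continuous

/-- The sets in `Aut.isClosed_setOf_realize` generate the closed sets of `Aut R`, so continuity can
be tested on them. -/
theorem Aut.continuous_of_isClosed {Z : Type*} [TopologicalSpace Z] {f : Z → Aut R}
    (h : ∀ φ : Formula L (fun s => R.carrier s ⊕ R.carrier s), IsLocalPositive φ →
      IsClosed {z | φ.Realize R (f z).toSelfMap.graph}) : Continuous f := by
  refine continuous_iInf_rng.2 fun X => continuous_iInf_rng.2 fun _ => continuous_iInf_rng.2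
    fun a => continuous_induced_rng.2 (continuous_iff_isClosed.2 fun D hD => ?_)
  rcases Tuple.isClosed_iff.1 hD with rfl | ⟨Δ, hΔ, rfl⟩
  · exact isClosed_empty
  · have : (Aut.ev a ∘ f) ⁻¹' {c | ∀ φ ∈ Δ, PFormula.Realize φ c} =
        ⋂ φ ∈ Δ, {z | (Formula.map (fun s => Sum.map (a s) id) φ).Realize R
          (f z).toSelfMap.graph} := by
      ext z
      simp only [Set.mem_iInter]
      refine forall₂_congr fun φ _ => Iff.trans (Formula.realize_congr fun s x => ?_) (Formula.realize_map _ φ R _).symm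
      rcases x with x | x <;> rfl
    rw [this]
    exact isClosed_biInter fun φ hφ => h _ ((hΔ φ hφ).map _)

theorem Aut.ultrafilter_le_nhds {𝒰 : Ultrafilter (Aut R)} {γ : Aut R}
    (h : ∀ φ : Formula L (fun s => R.carrier s ⊕ R.carrier s), IsLocalPositive φ →
      (∀ᶠ σ : Aut R in 𝒰, φ.Realize R σ.toSelfMap.graph) → φ.Realize R γ.toSelfMap.graph) :
    (𝒰 : Filter (Aut R)) ≤ nhds γ := by
  change _ ≤ @nhds _ (⨅ _, _) _
  simp only [nhds_iInf, nhds_induced]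
  refine le_iInf fun X => le_iInf fun _ => le_iInf fun a => Filter.map_le_iff_le_comap.1 ?_
  refine Tuple.ultrafilter_le_nhds (𝒰 := 𝒰.map (Aut.ev a)) fun φ hφ H => ?_
  have e : ∀ σ : Aut R, φ.Realize (σ.ev a) ↔
      (Formula.map (fun s => Sum.map (a s) id) φ).Realize R σ.toSelfMap.graph := by
    intro σ
    refine Iff.trans (Formula.realize_congr fun s x => ?_) (Formula.realize_map _ φ R _).symm
    rcases x with x | x <;> rfl
  refine (e γ).2 (h _ (hφ.map _) (Filter.Eventually.mono (Ultrafilter.mem_map.1 H)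
    fun σ hσ => (e σ).1 hσ))

/-! ### Automorphisms -/

theorem Aut.isHom (σ : Aut R) : IsHom (M := R) (N := R) fun s => σ.1 s := σ.2.1

theorem Aut.inv_apply (σ : Aut R) {s : L.Srt} (a : R.carrier s) : (σ⁻¹).1 s (σ.1 s a) = a :=
  (σ.1 s).symm_apply_apply a

theorem Aut.apply_inv (σ : Aut R) {s : L.Srt} (a : R.carrier s) : σ.1 s ((σ⁻¹).1 s a) = a :=
  (σ.1 s).apply_symm_apply a

theorem Aut.realize_iff (σ : Aut R) {φ : Formula L V} (hφ : IsPositive φ) (v : Tuple R V) :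
    φ.Realize R (fun s x => σ.1 s (v s x)) ↔ φ.Realize R v := by
  refine ⟨fun h => (Formula.realize_congr fun s x => ?_).1 ((σ⁻¹).isHom.realize _ hφ h), fun h => σ.isHom.realize v hφ h⟩
  exact σ.inv_apply _

/-- Applying `σ` turns `φ(σ⁻¹(a), b)` into `φ(a, σ(b))`, so inversion exchanges values and
parameters. -/
theorem Aut.continuous_inv : Continuous fun σ : Aut R => σ⁻¹ := by
  refine Aut.continuous_of_isClosed fun φ hφ => ?_
  have : {σ : Aut R | φ.Realize R (σ⁻¹).toSelfMap.graph} =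
      {σ : Aut R | (φ.map fun _ => Sum.swap).Realize R σ.toSelfMap.graph} := by
    ext σ
    refine (σ.realize_iff hφ.isPositive _).symm.trans
      (Iff.trans (Formula.realize_congr fun s x => ?_) (Formula.realize_map _ φ R _).symm)
    rcases x with x | x
    · exact σ.apply_inv x
    · rfl
  rw [this]
  exact Aut.isClosed_setOf_realize (hφ.map _)

/-- Applying `τ⁻¹` turns `φ(τσ(a), b)` into `φ(σ(a), τ⁻¹(b))`. -/
theorem Aut.continuous_mul_left (τ : Aut R) : Continuous fun σ : Aut R => τ * σ := by
  refine Aut.continuous_of_isClosed fun φ hφ => ?_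
  have : {σ : Aut R | φ.Realize R (τ * σ).toSelfMap.graph} =
      {σ : Aut R | (φ.map fun s => Sum.map id ((τ⁻¹).1 s)).Realize R σ.toSelfMap.graph} := by
    ext σ
    refine Iff.trans (Formula.realize_congr fun s x => ?_) ((τ.realize_iff hφ.isPositive _).trans
      (Formula.realize_map _ φ R _).symm)
    rcases x with x | x
    · rfl
    · exact (τ.apply_inv x).symm
  rw [this]
  exact Aut.isClosed_setOf_realize (hφ.map _)

theorem Aut.continuous_mul_right (τ : Aut R) : Continuous fun σ : Aut R => σ * τ := by
  refine Aut.continuous_of_isClosed fun φ hφ => ?_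
  have : {σ : Aut R | φ.Realize R (σ * τ).toSelfMap.graph} =
      {σ : Aut R | (φ.map fun s => Sum.map (τ.1 s) id).Realize R σ.toSelfMap.graph} := by
    ext σ
    refine Iff.trans (Formula.realize_congr fun s x => ?_) (Formula.realize_map _ φ R _).symm
    rcases x with x | x <;> rfl
  rw [this]
  exact Aut.isClosed_setOf_realize (hφ.map _)

theorem Aut.toSelfMap_injective : Function.Injective (Aut.toSelfMap : Aut R → SelfMap R) := by
  intro σ τ h
  refine Subtype.ext (funext fun s => Equiv.ext fun a => ?_)
  exact congrFun (congrFun h s) a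

theorem Aut.t1Space : T1Space (Aut R) := by
  refine ⟨fun τ => ?_⟩
  have : {τ} = ⋂ (s) (a : R.carrier s), {σ : Aut R | Formula.Realize
      (.loc 1 (.free (Sum.inl a)) (.free (Sum.inr (τ.1 s a)))) R σ.toSelfMap.graph} := by
    ext σ
    simp only [Set.mem_iInter, Set.mem_singleton_iff]
    constructor
    · rintro rfl s a
      exact (R.locMap_one _ _).2 rfl
    · intro h
      exact Aut.toSelfMap_injective (funext fun s => funext fun a => (R.locMap_one _ _).1 (h s a))
  rw [this]
  exact isClosed_iInter fun s => isClosed_iInter fun a => Aut.isClosed_setOf_realize (.loc _ _ _)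

theorem SelfMap.isClosed_setOf_isHom :
    IsClosed {f : SelfMap R | IsHom (M := R) (N := R) f} := by
  have : {f : SelfMap R | IsHom (M := R) (N := R) f} =
      (⋂ (l : List L.Srt) (Q : L.Rel l) (a : ∀ i : Fin l.length, R.carrier (l.get i))
          (_ : R.relMap Q a), {f : SelfMap R | Formula.Realize
            (.rel Q fun i => .free (Sum.inl (a i))) R f.graph}) ∩
      ((⋂ (s) (c : L.Const s), {f : SelfMap R | Formula.Realize
        (.loc 1 (.free (Sum.inl (R.constMap c))) (.const c)) R f.graph}) ∩
      ⋂ (s) (d : L.Loc s) (a : R.carrier s) (b : R.carrier s) (_ : R.locMap d a b),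
        {f : SelfMap R | Formula.Realize
          (.loc d (.free (Sum.inl a)) (.free (Sum.inl b))) R f.graph}) := by
    ext f
    simp only [Set.mem_inter_iff, Set.mem_iInter]
    constructor
    · intro hf
      exact ⟨fun l Q a h => hf.map_rel Q a h, fun s c => (R.locMap_one _ _).2 (hf.map_const c),
        fun s d a b h => hf.map_loc d a b h⟩
    · rintro ⟨h1, h2, h3⟩
      exact ⟨fun Q a h => h1 _ Q a h, fun c => (R.locMap_one _ _).1 (h2 _ c),
        fun d a b h => h3 _ d a b h⟩
  rw [this]
  refine .inter ?_ (.inter ?_ ?_)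
  · exact isClosed_iInter fun _ => isClosed_iInter fun _ => isClosed_iInter fun _ =>
      isClosed_iInter fun _ => SelfMap.isClosed_setOf_realize (.rel _ _)
  · exact isClosed_iInter fun _ => isClosed_iInter fun _ =>
      SelfMap.isClosed_setOf_realize (.loc _ _ _)
  · exact isClosed_iInter fun _ => isClosed_iInter fun _ => isClosed_iInter fun _ =>
      isClosed_iInter fun _ => isClosed_iInter fun _ => SelfMap.isClosed_setOf_realize (.loc _ _ _)

end LocalPositiveLogic

namespace LocalPositiveLogic

variable {L : LocalLanguage.{u}} {X V W : L.Srt → Type u} {R : LStructure L}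
  {T : Set (Sentence L)}

/-! ### Compactness of balls -/

theorem IsRetractor.isClosedEmbedding_toSelfMap (hR : IsRetractor T R) :
    Topology.IsClosedEmbedding (Aut.toSelfMap : Aut R → SelfMap R) := by
  refine ⟨⟨Aut.isInducing_toSelfMap, Aut.toSelfMap_injective⟩, ?_⟩
  have : Set.range (Aut.toSelfMap : Aut R → SelfMap R) =
      {f : SelfMap R | IsHom (M := R) (N := R) f} := by
    ext f
    exact ⟨fun ⟨σ, h⟩ => h ▸ σ.isHom, fun h => hR.exists_aut f h⟩
  rw [this]
  exact SelfMap.isClosed_setOf_isHom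

/-- The diagonal embedding in an ultrapower. -/
theorem isAlmostHom_const {I : Type u} (𝒰 : Ultrafilter I) (R : LStructure L) :
    IsAlmostHom 𝒰 R (fun _ => R) fun _ r _ => r :=
  ⟨fun _ _ h => .of_forall fun _ => h, fun _ => .of_forall fun _ => rfl,
    fun _ _ _ h => .of_forall fun _ => h⟩

/-- An ultrafilter on tuples serves as its own index: the coordinate maps `a ↦ a s i` are elements
of the ultrapower, bounded because the ultrafilter contains the ball. Their retractions form the
limit. -/
theorem IsRetractor.isCompact_ball (hT : ∀ φ ∈ T, IsNegative φ) (hR : IsRetractor T R)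
    (d : ∀ s, X s → L.Loc s) (b : Tuple R X) : IsCompact (ball R d b) := by
  refine isCompact_iff_ultrafilter_le_nhds.2 fun 𝒰 h𝒰 => ?_
  have hB : ∀ᶠ a in (𝒰 : Filter (Tuple R X)), a ∈ ball R d b := Filter.le_principal_iff.1 h𝒰
  have hh := isAlmostHom_const 𝒰 R
  obtain ⟨g, hg, H⟩ := hR.exists_retraction hT 𝒰 _ (fun _ => hR.1) _ hh
  let x : ∀ s, X s → BoundedElem 𝒰 R (fun _ => R) (fun _ r _ => r) s := fun s i =>
    ⟨fun a => a s i, b s i, d s i, hB.mono fun a ha => ha s i⟩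
  let v : ∀ s, X s ⊕ R.carrier s → BoundedElem 𝒰 R (fun _ => R) (fun _ r _ => r) s :=
    fun s => Sum.elim (x s) hh.base
  let c : Tuple R X := fun s i => g s (x s i)
  have key : ∀ φ : PFormula R X, IsLocalPositive φ →
      (∀ᶠ a in (𝒰 : Filter (Tuple R X)), φ.Realize a) → φ.Realize c := by
    intro φ hφ h
    refine (Formula.realize_congr fun s y => ?_).1 (H v φ hφ (h.mono fun a ha =>
      (Formula.realize_congr fun s y => ?_).1 ha))
    · rcases y with y | y
      · rfl
      · exact hg s y
    · rcases y with y | y <;> rfl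
  refine ⟨c, fun s i => ?_, Tuple.ultrafilter_le_nhds key⟩
  exact key (.loc (d s i) (.free (Sum.inr (b s i))) (.free (Sum.inl i))) (.loc _ _ _)
    (hB.mono fun a ha => ha s i)

/-- Controlling one point in each sort controls all of them: `σ(r)` is as close to `σ(a s)` as `r`
is to `a s`. Hence `σ ↦ σ(r)` is bounded for every `r`, and retracting these elements gives an
endomorphism to which the ultrafilter converges. -/
theorem IsRetractor.isCompact_autBall (hT : ∀ φ ∈ T, IsNegative φ) (hR : IsRetractor T R)
    (d : ∀ s, L.Loc s) (a : ∀ s, R.carrier s) : IsCompact (Aut.ball R d a) := by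
  refine isCompact_iff_ultrafilter_le_nhds.2 fun 𝒰 h𝒰 => ?_
  have hB : ∀ᶠ σ in (𝒰 : Filter (Aut R)), σ ∈ Aut.ball R d a := Filter.le_principal_iff.1 h𝒰
  have hh := isAlmostHom_const 𝒰 R
  obtain ⟨g, hg, H⟩ := hR.exists_retraction hT 𝒰 _ (fun _ => hR.1) _ hh
  have hx : ∀ s (r : R.carrier s), ∃ (r' : R.carrier s) (e : L.Loc s),
      ∀ᶠ σ : Aut R in 𝒰, R.locMap e r' (σ.1 s r) := by
    intro s r
    obtain ⟨e, he⟩ := hR.1.1.exists_loc (a s) r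
    exact ⟨a s, d s * e, hB.mono fun σ hσ =>
      hR.1.1.comp _ _ _ _ _ (hσ s) (σ.isHom.map_loc e _ _ he)⟩
  let x : ∀ s, R.carrier s → BoundedElem 𝒰 R (fun _ => R) (fun _ r _ => r) s := fun s r =>
    ⟨fun σ => σ.1 s r, hx s r⟩
  let v : ∀ s, R.carrier s ⊕ R.carrier s → BoundedElem 𝒰 R (fun _ => R) (fun _ r _ => r) s :=
    fun s => Sum.elim (x s) hh.base
  let f : SelfMap R := fun s r => g s (x s r)
  have key : ∀ φ : Formula L (fun s => R.carrier s ⊕ R.carrier s), IsLocalPositive φ →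
      (∀ᶠ σ : Aut R in 𝒰, φ.Realize R σ.toSelfMap.graph) → φ.Realize R f.graph := by
    intro φ hφ h
    refine (Formula.realize_congr fun s y => ?_).1 (H v φ hφ (h.mono fun a ha =>
      (Formula.realize_congr fun s y => ?_).1 ha))
    · rcases y with y | y
      · rfl
      · exact hg s y
    · rcases y with y | y <;> rfl
  obtain ⟨γ, hγ⟩ : ∃ γ : Aut R, γ.toSelfMap = f := by
    refine hR.exists_aut f ⟨fun Q b h => ?_, fun c => ?_, fun e b b' h => ?_⟩
    · exact key (.rel Q fun i => .free (Sum.inl (b i))) (.rel _ _)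
        (.of_forall fun σ => σ.isHom.map_rel Q b h)
    · exact (R.locMap_one _ _).1 (key (.loc 1 (.free (Sum.inl (R.constMap c))) (.const c))
        (.loc _ _ _) (.of_forall fun σ => (R.locMap_one _ _).2 (σ.isHom.map_const c)))
    · exact key (.loc e (.free (Sum.inl b)) (.free (Sum.inl b'))) (.loc _ _ _)
        (.of_forall fun σ => σ.isHom.map_loc e b b' h)
  rw [← hγ] at key
  refine ⟨γ, fun s => ?_, Aut.ultrafilter_le_nhds key⟩
  exact key (.loc (d s) (.free (Sum.inr (a s))) (.free (Sum.inl (a s)))) (.loc _ _ _)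
    (hB.mono fun σ hσ => hσ s)

/-! ### Closed sets in balls -/

/-- The formula sees finitely many coordinates of `a`, and the others may be taken equal to those of
`σ.ev b`. What remains is a finite string of local quantifiers bounded by values of `σ`. -/
theorem isClosed_setOf_exists_mem_ball_realize (hR : R.IsLocal)
    (d : ∀ s, X s → L.Loc s) (b : Tuple R X)
    {φ : Formula L (fun s => X s ⊕ (R.carrier s ⊕ R.carrier s))} (hφ : IsLocalPositive φ) :
    IsClosed {σ : Aut R | ∃ a ∈ ball R d (σ.ev b), φ.Realize R (a.append σ.toSelfMap.graph)} := by
  classical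
  obtain ⟨S, hS, h⟩ := Formula.exists_support hφ.isPositive
  let l : List (Σ s, X s) := (hS.preimage (f := fun y : Σ s, X s =>
    (⟨y.1, Sum.inl y.2⟩ : Σ s, X s ⊕ (R.carrier s ⊕ R.carrier s))) (by
      rintro ⟨s, x⟩ - ⟨t, y⟩ - hxy
      cases hxy
      rfl)).toFinset.toList
  have hl : ∀ s (y : X s), ⟨s, Sum.inl y⟩ ∈ S → ⟨s, y⟩ ∈ l := fun s y hy => by
    simp only [l, Finset.mem_toList, Set.Finite.mem_toFinset]
    exact hy
  obtain ⟨θ, hθ, H⟩ := exists_localPositive_exists_agree d (fun s x => Sum.inl (b s x)) φ hφ l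
  let ρ : ∀ s, X s ⊕ (R.carrier s ⊕ R.carrier s) → R.carrier s ⊕ R.carrier s :=
    fun s => Sum.elim (fun x => Sum.inl (b s x)) id
  have : {σ : Aut R | ∃ a ∈ ball R d (σ.ev b), φ.Realize R (a.append σ.toSelfMap.graph)} =
      {σ : Aut R | (θ.map ρ).Realize R σ.toSelfMap.graph} := by
    ext σ
    have e : (θ.map ρ).Realize R σ.toSelfMap.graph ↔
        θ.Realize R ((σ.ev b).append σ.toSelfMap.graph) := by
      refine (Formula.realize_map ρ θ R _).trans (Formula.realize_congr fun s x => ?_)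
      rcases x with x | x <;> rfl
    refine Iff.trans ?_ (e.trans (H R _ _)).symm
    constructor
    · rintro ⟨a, ha, hφa⟩
      refine ⟨fun s x => if (⟨s, x⟩ : Σ s, X s) ∈ l then a s x else σ.ev b s x,
        fun s x hx => if_neg hx, fun s x hx => ?_, (h R _ _ fun s x hx => ?_).1 hφa⟩
      · change R.locMap _ (ite _ _ _) _
        rw [if_pos hx]
        exact hR.symm _ _ _ (ha s x)
      · rcases x with x | x
        · exact (if_pos (hl s x hx)).symm
        · rfl
    · rintro ⟨a, h1, h2, h3⟩
      refine ⟨a, fun s x => ?_, h3⟩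
      by_cases hx : (⟨s, x⟩ : Σ s, X s) ∈ l
      · exact hR.symm _ _ _ (h2 s x hx)
      · rw [h1 s x hx]
        exact hR.loc_self _ _
  rw [this]
  exact Aut.isClosed_setOf_realize (hθ.map ρ)

/-- Compactness of the ball around `σ.ev b` lets the existential quantifier pass through the
infinite conjunction, leaving one closed condition for each finite subfamily. -/
theorem IsRetractor.isClosed_setOf_exists_mem_ball (hT : ∀ φ ∈ T, IsNegative φ)
    (hR : IsRetractor T R) (d : ∀ s, X s → L.Loc s) (b : Tuple R X) {J : Type*}
    (χ : J → Formula L (fun s => X s ⊕ (R.carrier s ⊕ R.carrier s)))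
    (hχ : ∀ j, IsLocalPositive (χ j)) :
    IsClosed {σ : Aut R | ∃ a ∈ ball R d (σ.ev b),
      ∀ j, (χ j).Realize R (a.append σ.toSelfMap.graph)} := by
  have : {σ : Aut R | ∃ a ∈ ball R d (σ.ev b),
      ∀ j, (χ j).Realize R (a.append σ.toSelfMap.graph)} =
      ⋂ F : Finset J, {σ : Aut R | ∃ a ∈ ball R d (σ.ev b),
        ∀ j ∈ F, (χ j).Realize R (a.append σ.toSelfMap.graph)} := by
    ext σ
    simp only [Set.mem_iInter]
    refine ⟨fun ⟨a, ha, h⟩ F => ⟨a, ha, fun j _ => h j⟩, fun h => ?_⟩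
    obtain ⟨a, ha, h'⟩ := (hR.isCompact_ball hT d (σ.ev b)).inter_iInter_nonempty
      (fun j => {a | (χ j).Realize R (a.append σ.toSelfMap.graph)})
      (fun j => isClosed_setOf_realize (hχ j) _) (fun F => by
        obtain ⟨a, ha, h'⟩ := h F
        exact ⟨a, ha, Set.mem_iInter₂.2 h'⟩)
    exact ⟨a, ha, fun j => Set.mem_iInter.1 h' j⟩
  rw [this]
  refine isClosed_iInter fun F => ?_
  rcases exists_localPositive_forall_mem χ hχ F with rfl | ⟨φ, hφ, h⟩
  · convert isClosed_univ
    refine Set.eq_univ_of_forall fun σ => ⟨σ.ev b, fun s x => hR.1.1.loc_self _ _, by simp⟩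
  · simp only [← h]
    exact isClosed_setOf_exists_mem_ball_realize hR.1.1 d b hφ

/-- The complement is described through the image point `σ(a)`: it lies in the ball around `σ(b)`,
satisfies the formulas of `F` with parameters moved by `σ`, and satisfies those of `Uᶜ` with
parameters unchanged. Thus `ρ` sends parameters to the values of `σ`, and `ρ'` to the fixed copy of
`R`. -/
theorem IsRetractor.isOpen_setOf_mapsTo (hT : ∀ φ ∈ T, IsNegative φ) (hR : IsRetractor T R)
    (d : ∀ s, X s → L.Loc s) (b : Tuple R X) {F U : Set (Tuple R X)} (hFb : F ⊆ ball R d b)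
    (hF : IsClosed F) (hU : IsOpen U) : IsOpen {σ : Aut R | ∀ a ∈ F, σ.ev a ∈ U} := by
  rcases Tuple.isClosed_iff.1 hF with rfl | ⟨Δ, hΔ, hFΔ⟩
  · simp
  rcases Tuple.isClosed_iff.1 hU.isClosed_compl with hU' | ⟨Δ', hΔ', hUΔ⟩
  · rw [Set.compl_empty_iff] at hU'
    simp [hU']
  let ρ : ∀ s, X s ⊕ R.carrier s → X s ⊕ (R.carrier s ⊕ R.carrier s) := fun s =>
    Sum.map id Sum.inl
  let ρ' : ∀ s, X s ⊕ R.carrier s → X s ⊕ (R.carrier s ⊕ R.carrier s) := fun s =>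
    Sum.map id Sum.inr
  let χ : Δ ⊕ Δ' → Formula L (fun s => X s ⊕ (R.carrier s ⊕ R.carrier s)) :=
    Sum.elim (fun φ => Formula.map ρ φ.1) fun φ => Formula.map ρ' φ.1
  have hχ : ∀ j, IsLocalPositive (χ j) := by
    rintro (j | j)
    · exact (hΔ _ j.2).map ρ
    · exact (hΔ' _ j.2).map ρ'
  have e : ∀ (σ : Aut R) (a : Tuple R X), a ∈ F ↔
      ∀ φ : Δ, (χ (Sum.inl φ)).Realize R (Tuple.append (σ.ev a) σ.toSelfMap.graph) := by
    intro σ a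
    rw [hFΔ, Subtype.forall]
    refine forall₂_congr fun φ hφ => ?_
    refine (σ.realize_iff (hΔ φ hφ).isPositive _).symm.trans
      (Iff.trans (Formula.realize_congr fun s x => ?_) (Formula.realize_map ρ φ R _).symm)
    rcases x with x | x <;> rfl
  have e' : ∀ (σ : Aut R) (a : Tuple R X), a ∈ Uᶜ ↔
      ∀ φ : Δ', (χ (Sum.inr φ)).Realize R (a.append σ.toSelfMap.graph) := by
    intro σ a
    rw [hUΔ, Subtype.forall]
    refine forall₂_congr fun φ hφ => ?_
    refine Iff.trans (Formula.realize_congr fun s x => ?_) (Formula.realize_map ρ' φ R _).symm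
    rcases x with x | x <;> rfl
  rw [← isClosed_compl_iff]
  convert hR.isClosed_setOf_exists_mem_ball hT d b χ hχ using 1
  ext σ
  simp only [Set.mem_compl_iff, Set.mem_ofPred_eq, not_forall, exists_prop, Sum.forall, ← e']
  constructor
  · rintro ⟨a, ha, hU⟩
    exact ⟨σ.ev a, fun s x => σ.isHom.map_loc _ _ _ (hFb ha s x), (e σ a).1 ha, hU⟩
  · rintro ⟨a, -, h, hU⟩
    have ha : σ.ev ((σ⁻¹).ev a) = a := funext fun s => funext fun x => σ.apply_inv (a s x)
    refine ⟨(σ⁻¹).ev a, (e σ _).2 ?_, ?_⟩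
    · rwa [ha]
    · rwa [ha]

/-! ### Denials in retractors and entourages -/

/-- In a retractor, the failure of a local positive formula is witnessed by a denial. -/
theorem IsRetractor.exists_denial (hT : ∀ φ ∈ T, IsNegative φ) (hR : IsRetractor T R)
    {φ : Formula L V} (hφ : IsLocalPositive φ) {v : Tuple R V} (hv : ¬ φ.Realize R v)
    {s₀ : L.Srt} (x₀ : V s₀) :
    ∃ θ : Formula L V, IsPositive θ ∧ θ.Realize R v ∧ Perp T {φ} θ := by
  by_contra hcon
  -- The positive diagram of `R` together with `v`. If no denial of `φ` holds at `v`, each of its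
  -- formulas is realised in a local model jointly with `φ`.
  let A : Type u := {α : Formula L (fun s => V s ⊕ R.carrier s) //
    IsPositive α ∧ α.Realize R (v.append (W := R.carrier) fun _ m => m)}
  have hA : ∀ α : A, ∃ N : LStructure L, IsLocalModel T N ∧ ∃ (a : Tuple N V)
      (e : ∀ s, R.carrier s → N.carrier s),
      φ.Realize N a ∧ α.1.Realize N (a.append (W := R.carrier) e) := by
    rintro ⟨α, hα, hαv⟩
    obtain ⟨θ, hθ, h⟩ := hα.exists_realize_iff_exists_append
    by_contra hN
    -- Otherwise, quantifying out the parameters of `α` would give a denial of `φ` true at `v`.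
    refine hcon ⟨θ, hθ, (h R v).2 ⟨_, hαv⟩, fun N hNT a ha => hN ⟨N, hNT, a, ?_⟩⟩
    obtain ⟨e, he⟩ := (h N a).1 ha.2
    exact ⟨e, ha.1 φ rfl, he⟩
  choose N hN a e hφa hα using hA
  -- Each `α` must hold in almost all models, so the filter is generated by the sets of `β` implying
  -- `α`; conjunctions make these directed.
  let 𝓕 : Filter A := ⨅ α : A, Filter.principal
    {β : A | ∀ (M : LStructure L) (w : Tuple M _), β.1.Realize M w → α.1.Realize M w}
  -- The variable `x₀` provides the formula `x₀ = x₀`.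
  have : Nonempty A := ⟨⟨.loc 1 (.free (Sum.inl x₀)) (.free (Sum.inl x₀)), .loc _ _ _,
    (R.locMap_one _ _).2 rfl⟩⟩
  have h𝓕 : 𝓕.NeBot := by
    refine Filter.iInf_neBot_of_directed' ?_ fun α =>
      Filter.principal_neBot_iff.2 ⟨α, fun _ _ h => h⟩
    intro α β
    refine ⟨⟨.and α.1 β.1, .and α.2.1 β.2.1, α.2.2, β.2.2⟩, ?_, ?_⟩
    · exact Filter.principal_mono.2 fun γ hγ M w h => (hγ M w h).1
    · exact Filter.principal_mono.2 fun γ hγ M w h => (hγ M w h).2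
  let 𝒰 : Ultrafilter A := Ultrafilter.of 𝓕
  have key : ∀ α : Formula L (fun s => V s ⊕ R.carrier s), IsPositive α →
      α.Realize R (v.append (W := R.carrier) fun _ m => m) →
      ∀ᶠ β in (𝒰 : Filter A), α.Realize (N β) ((a β).append (W := R.carrier) (e β)) := by
    intro α hα1 hα2
    have h1 : {β : A | ∀ (M : LStructure L) (w : Tuple M _), β.1.Realize M w → α.Realize M w} ∈ 𝓕 :=
      Filter.mem_iInf_of_mem (⟨α, hα1, hα2⟩ : A) (Filter.mem_principal_self _)
    exact Filter.mem_of_superset (Ultrafilter.of_le 𝓕 h1) fun β hβ => hβ _ _ (hα β)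
  have hh : IsAlmostHom 𝒰 R N fun s r β => e β s r := by
    refine ⟨fun Q b h => ?_, fun c => ?_, fun d b b' h => ?_⟩
    · exact key (.rel Q fun i => .free (Sum.inr (b i))) (.rel _ _) h
    · exact (key (.loc 1 (.free (Sum.inr (R.constMap c))) (.const c)) (.loc _ _ _)
        ((R.locMap_one _ _).2 rfl)).mono fun β hβ => ((N β).locMap_one _ _).1 hβ
    · exact key (.loc d (.free (Sum.inr b)) (.free (Sum.inr b'))) (.loc _ _ _) h
  have hv' : ∀ s (x : V s), ∀ᶠ β in (𝒰 : Filter A), (N β).locMap 1 (e β s (v s x)) (a β s x) :=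
    fun s x => key (.loc 1 (.free (Sum.inr (v s x))) (.free (Sum.inl x))) (.loc _ _ _)
      ((R.locMap_one _ _).2 rfl)
  let y : ∀ s, V s → BoundedElem 𝒰 R N (fun s r β => e β s r) s := fun s x =>
    ⟨fun β => a β s x, v s x, 1, hv' s x⟩
  obtain ⟨g, hg, H⟩ := hR.exists_retraction hT 𝒰 N hN _ hh
  -- The diagram contains the equality of each variable with its value under `v`, so the limit of
  -- the realisations of `φ` is `v` itself.
  have hgy : ∀ s (x : V s), g s (y s x) = v s x := by
    intro s x
    let z : ∀ s, V s ⊕ R.carrier s → BoundedElem 𝒰 R N (fun s r β => e β s r) s :=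
      fun s => Sum.elim (y s) hh.base
    have h1 := H z (.loc 1 (.free (Sum.inr (v s x))) (.free (Sum.inl x))) (.loc _ _ _) (hv' s x)
    exact ((R.locMap_one _ _).1 h1).symm.trans (hg s (v s x))
  exact hv ((Formula.realize_congr hgy).1 (H y φ hφ (.of_forall hφa)))

/-- If `φ` and some component of `d` both failed at `(b, a)`, each failure would be witnessed there
by a denial, `θ` and `η`. But `η` is then a denial of `ψ`, so complementarity makes `θ` and `η`
incompatible. -/
theorem IsRetractor.loc_of_isEntourage (hT : ∀ φ ∈ T, IsNegative φ) (hR : IsRetractor T R)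
    {d : ∀ s, X s → L.Loc s} {ψ φ : Formula L (fun s => X s ⊕ X s)} (h : IsEntourage T d ψ φ)
    {a b : Tuple R X} (hab : ¬ φ.Realize R (b.append a)) : a ∈ ball R d b := by
  intro s i
  by_contra hd
  obtain ⟨θ, hθ, hθR, hθT⟩ := hR.exists_denial hT h.right_localPositive hab (Sum.inl i)
  let χ : Formula L (fun s => X s ⊕ X s) :=
    .loc (d s i) (.free (Sum.inl i)) (.free (Sum.inr i))
  obtain ⟨η, hη, hηR, hηT⟩ := hR.exists_denial hT (φ := χ) (.loc _ _ _) (v := b.append a) hd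
    (Sum.inl i)
  have h1 : Perp T {ψ} η := h.approximates η hη fun N hN v hv =>
    hηT N hN v ⟨fun _ hφ' => hφ' ▸ hv.1 _ ⟨s, i, rfl⟩, hv.2⟩
  exact h.complementary η hη h1 θ hθ hθT R hR.1 _ ⟨fun _ hφ' => hφ' ▸ hηR, hθR⟩

/-- The set where `φ(b, ·)` fails is open, contains `b` because `φ` is incompatible with equality,
and lies inside the ball. -/
theorem IsRetractor.ball_mem_nhds (hT : ∀ φ ∈ T, IsNegative φ) (hR : IsRetractor T R)
    {d : ∀ s, X s → L.Loc s} {ψ φ : Formula L (fun s => X s ⊕ X s)} (h : IsEntourage T d ψ φ)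
    (b : Tuple R X) : ball R d b ∈ nhds b := by
  have hc : IsClosed {a : Tuple R X | φ.Realize R (b.append a)} := by
    convert isClosed_setOf_realize (h.right_localPositive.map fun _ => Sum.swap) b using 1
    ext a
    refine Iff.trans (Formula.realize_congr fun s x => ?_) (Formula.realize_map _ φ R _).symm
    rcases x with x | x <;> rfl
  refine Filter.mem_of_superset (hc.isOpen_compl.mem_nhds fun hb => ?_)
    fun a ha => hR.loc_of_isEntourage hT h ha
  refine h.perp_eq R hR.1 (b.append b) ⟨?_, hb⟩
  rintro _ ⟨s, i, rfl⟩
  exact (R.locMap_one _ _).2 rfl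

theorem IsRetractor.isOpen_setOf_mapsTo_of_isCompact (hT : ∀ φ ∈ T, IsNegative φ)
    (hR : IsRetractor T R) {d : ∀ s, X s → L.Loc s} {ψ φ : Formula L (fun s => X s ⊕ X s)}
    (h : IsEntourage T d ψ φ) {F U : Set (Tuple R X)} (hF : IsClosed F) (hF' : IsCompact F)
    (hU : IsOpen U) : IsOpen {σ : Aut R | ∀ a ∈ F, σ.ev a ∈ U} := by
  -- Finitely many balls cover `F`, so the condition splits into finitely many instances of
  -- `IsRetractor.isOpen_setOf_mapsTo`.
  obtain ⟨t, -, ht⟩ := hF'.elim_nhds_subcover (ball R d) fun b _ => hR.ball_mem_nhds hT h b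
  have : {σ : Aut R | ∀ a ∈ F, σ.ev a ∈ U} =
      ⋂ b ∈ t, {σ : Aut R | ∀ a ∈ F ∩ ball R d b, σ.ev a ∈ U} := by
    ext σ
    simp only [Set.mem_iInter]
    refine ⟨fun hσ b _ a ha => hσ a ha.1, fun hσ a ha => ?_⟩
    obtain ⟨b, hb, hab⟩ := Set.mem_iUnion₂.1 (ht ha)
    exact hσ b hb a ⟨ha, hab⟩
  rw [this]
  exact isOpen_biInter_finset fun b _ => hR.isOpen_setOf_mapsTo hT d b Set.inter_subset_right
    (hF.inter (Tuple.isClosed_ball d b)) hU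

end LocalPositiveLogic

theorem mainTheorem10 (L : LocalPositiveLogic.LocalLanguage.{u})
    (T : Set (LocalPositiveLogic.Sentence L)) (hT : LocalPositiveLogic.IsNegativeLocalTheory T)
    (R : LocalPositiveLogic.LStructure L) (hR : LocalPositiveLogic.IsRetractor T R) :
    -- `Aut(R)` is a closed subspace of the space of all functions on `R`
    Topology.IsClosedEmbedding
      (LocalPositiveLogic.Aut.toSelfMap :
        LocalPositiveLogic.Aut R → LocalPositiveLogic.SelfMap R) ∧
    -- sets of automorphisms mapping a closed subset of a ball into an open set are open
    (∀ (X : L.Srt → Type u) (d : ∀ s, X s → L.Loc s) (b : LocalPositiveLogic.Tuple R X)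
      (F U : Set (LocalPositiveLogic.Tuple R X)),
      F ⊆ LocalPositiveLogic.ball R d b → IsClosed F → IsOpen U →
        IsOpen {σ : LocalPositiveLogic.Aut R | ∀ a ∈ F, LocalPositiveLogic.Aut.ev a σ ∈ U}) ∧
    -- the same for closed compact sets, if there is an entourage
    (∀ (X : L.Srt → Type u),
      (∃ (d : ∀ s, X s → L.Loc s)
        (ψ φ : LocalPositiveLogic.Formula L (fun s => X s ⊕ X s)),
        LocalPositiveLogic.IsEntourage T d ψ φ) →
      ∀ F U : Set (LocalPositiveLogic.Tuple R X), IsClosed F → IsCompact F → IsOpen U →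
        IsOpen {σ : LocalPositiveLogic.Aut R | ∀ a ∈ F, LocalPositiveLogic.Aut.ev a σ ∈ U}) ∧
    -- `Aut(R)` is T₁
    T1Space (LocalPositiveLogic.Aut R) ∧
    -- balls of `Aut(R)` are compact
    (∀ (d : ∀ s, L.Loc s) (a : ∀ s, R.carrier s),
      IsCompact (LocalPositiveLogic.Aut.ball R d a)) ∧
    -- `Aut(R)` is a semitopological group
    Continuous (fun σ : LocalPositiveLogic.Aut R => σ⁻¹) ∧
    (∀ τ : LocalPositiveLogic.Aut R,
      Continuous (fun σ : LocalPositiveLogic.Aut R => τ * σ) ∧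
      Continuous (fun σ : LocalPositiveLogic.Aut R => σ * τ)) := by
  have hT' := hT.isNegative
  exact ⟨hR.isClosedEmbedding_toSelfMap,
    fun _ d b _ _ hFb hF hU => hR.isOpen_setOf_mapsTo hT' d b hFb hF hU,
    fun _ ⟨_, _, _, h⟩ _ _ hF hF' hU => hR.isOpen_setOf_mapsTo_of_isCompact hT' h hF hF' hU,
    LocalPositiveLogic.Aut.t1Space, hR.isCompact_autBall hT',
    LocalPositiveLogic.Aut.continuous_inv,
    fun τ => ⟨LocalPositiveLogic.Aut.continuous_mul_left τ,
      LocalPositiveLogic.Aut.continuous_mul_right τ⟩⟩
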